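/- **Setting.** Let $\varphi^D(z)=\sum_{m\in\mathbb Z}\varphi_{-m-\frac12}z^m$ be the neutral fermion field, whose modes $\varphi_r$ ($r\in\mathbb Z+\frac12$) satisfy $\{\varphi_r,\varphi_s\}=\delta_{r,-s}$, and let $F^{\otimes\frac12}$ be its Fock space over $\mathbb C$: $\varphi_r|0\rangle=0$ for $r>0$, and the monomials $\varphi_{-n_k-\frac12}\cdots\varphi_{-n_1-\frac12}|0\rangle$ with $n_k>\dots>n_1\ge 0$ form a basis. For $m\in\mathbb Z$ let $F_{(m)}\subset F^{\otimes\frac12}$ be the span of those monomials with $\#\{i: n_i \text{ odd}\}-\#\{i: n_i\text{ even}\}=m$. Let $F^{\otimes1}$ be the Fock space over $\mathbb C$ of the charged fermions $\psi^\pm(z)=\sum_{n\in\mathbb Z}\psi^\pm_nz^{-n-1}$, with $\{\psi^+_m,\psi^-_n\}=\delta_{m+n,-1}$, $\{\psi^\pm_m,\psi^\pm_n\}=0$, $\psi^\pm_n|0\rangle=0$ for $n\ge0$. For odd fields put $:a(z)b(w):\;=a(z)_+b(w)-b(w)a(z)_-$, where $a(z)_+$ (respectively $a(z)_-$) is the part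 of $a(z)$ with nonnegative (respectively negative) powers of $z$, and obtain $:a(z)b(z):$ by setting $w=z$. Write $\partial_{z^2}=\frac1{2z}\partial_z$. Let $\mathcal D$ be the Lie algebra of differential operators on the circle, i.e. of the operators $\sum_j a_j(t)\partial_t^j$ (finite sums, $a_j\in\mathbb C[t,t^{-1}]$) with the commutator bracket, with basis $J^k_n=t^{n+k}(-\partial_t)^k$ ($k\in\mathbb Z_{\ge0}$, $n\in\mathbb Z$), and let $\widehat{\mathcal D}=W_{1+\infty}=\mathcal D\oplus\mathbb CC$ be its universal central extension, with bracket $[A+aC,B+bC]=[A,B]+\Psi(A,B)C$, where $\Psi$ is the bilinear antisymmetric form with $$\Psi\bigl(t^rf(t\partial_t),t^sg(t\partial_t)\bigr)=\delta_{r+s,0}\sum_{-r\le j\le -1}f(j)\,g(j+r)\qquad (r\ge0)$$ for polynomials $f,g$. Write $J^k_n$ also for the element $J^k_n+0\cdot C$ of $\widehat{\mathcal D}$. **Proposition.** 1. For every $k\ge0$ the field $\frac{(-1)^k}{4z}:\bigl(\varphi^D(z)-\varphi^D(-z)\bigr)\,\partial_{z^2}^k\bigl(\varphi^D(z)+\varphi^D(-z)\bigr):$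 contains only even powers of $z$, and the assignment $$J^k(z^2)=\sum_{n\in\mathbb Z}J^k_n z^{-2k-2n-2}\;\longmapsto\;\frac{(-1)^k}{4z}:\bigl(\varphi^D(z)-\varphi^D(-z)\bigr)\,\partial_{z^2}^k\bigl(\varphi^D(z)+\varphi^D(-z)\bigr):\qquad(k\ge0)$$ extends to a unique representation of the Lie algebra $\widehat{\mathcal D}=W_{1+\infty}$ on $F^{\otimes\frac12}$; in it $C$ acts as the identity. 2. $F^{\otimes\frac12}=\bigoplus_{m\in\mathbb Z}F_{(m)}$, and each $F_{(m)}$ is a $\widehat{\mathcal D}$-submodule, irreducible under this action. 3. The assignment $\sum_{n\in\mathbb Z}J^k_nz^{-n-k-1}\longmapsto(-1)^k:\psi^+(z)\partial_z^k\psi^-(z):$ ($k\ge0$) gives a representation of $\widehat{\mathcal D}$ on $F^{\otimes1}$, and $$F^{\otimes1}\;\cong\;F^{\otimes\frac12}=\bigoplus_{m\in\mathbb Z}F_{(m)}$$ as $\widehat{\mathcal D}$-modules. -/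

import Mathlib

open scoped LaurentPolynomial Polynomial

attribute [local instance 100] LieRing.ofAssociativeRing

noncomputable section


/-! ### Fermionic Fock spaces -/

/-- The fermionic Fock space with one creation operator for every element of a linearly ordered
index set: the complex vector space with basis `e_S`, for `S` a finite set of indices. The basis
vector of `S = {i₁ < i₂ < ⋯ < iₖ}` is the monomial `c_{iₖ} ⋯ c_{i₂} c_{i₁} |0⟩`. -/
abbrev Fock (ι : Type) : Type := Finset ι →₀ ℂ

namespace Fock

set_option linter.unusedSectionVars false

variable {ι : Type} [LinearOrder ι]

/-- The monomial basis vector `e_S`. -/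
def mono (S : Finset ι) : Fock ι := Finsupp.single S 1

/-- The vacuum vector `|0⟩`. -/
def vac : Fock ι := mono ∅

/-- The sign picked up when an operator is moved to the position of index `i` in the monomial of
`S`, past the factors of larger index. -/
def sgn (S : Finset ι) (i : ι) : ℂ := (-1) ^ (S.filter (fun j => i < j)).card

/-- The creation operator with index `i`: left multiplication by `c_i`. -/
def create (i : ι) : Module.End ℂ (Fock ι) :=
  Finsupp.linearCombination ℂ fun S => if i ∈ S then 0 else sgn S i • mono (insert i S)

/-- The annihilation operator with index `i`, dual to the creation operator with index `i`. -/
def annih (i : ι) : Module.End ℂ (Fock ι) :=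
  Finsupp.linearCombination ℂ fun S => if i ∈ S then sgn S i • mono (S.erase i) else 0

theorem create_mono (i : ι) (S : Finset ι) :
    create i (mono S) = if i ∈ S then 0 else sgn S i • mono (insert i S) := by
  simp [create, mono]

theorem annih_mono (i : ι) (S : Finset ι) :
    annih i (mono S) = if i ∈ S then sgn S i • mono (S.erase i) else 0 := by
  simp [annih, mono]

theorem end_ext {A B : Module.End ℂ (Fock ι)} (h : ∀ S, A (mono S) = B (mono S)) : A = B := by
  refine Finsupp.lhom_ext fun S c => ?_
  have : Finsupp.single S c = c • mono S := by simp [mono]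
  rw [this, map_smul, map_smul, h]

theorem sgn_mul_self (S : Finset ι) (i : ι) : sgn S i * sgn S i = 1 := by
  rw [sgn, ← pow_add]; exact Even.neg_one_pow ⟨_, rfl⟩

theorem sgn_insert {S : Finset ι} {i j : ι} (hj : j ∉ S) :
    sgn (insert j S) i = (if i < j then -1 else 1) * sgn S i := by
  unfold sgn
  rw [Finset.filter_insert]
  split_ifs with h
  · rw [Finset.card_insert_of_notMem (by simp [hj]), pow_succ]; ring
  · ring

theorem sgn_erase {S : Finset ι} {i j : ι} (hj : j ∈ S) :
    sgn (S.erase j) i = (if i < j then -1 else 1) * sgn S i := by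
  conv_rhs => rw [← Finset.insert_erase hj]
  rw [sgn_insert (Finset.notMem_erase j S), ← mul_assoc]
  split_ifs <;> ring

/-- Creation operators anticommute. -/
theorem create_create (i j : ι) : create i * create j + create j * create i = 0 := by
  refine end_ext fun S => ?_
  by_cases hij : i = j
  · subst hij
    by_cases hi : i ∈ S <;> simp [create_mono, hi]
  · by_cases hi : i ∈ S <;> by_cases hj : j ∈ S <;>
      simp [create_mono, hi, hj, hij, Ne.symm hij, sgn_insert, smul_smul, Finset.insert_comm i j]
    rcases lt_or_gt_of_ne hij with h | h <;> simp [h, h.not_gt, mul_comm (sgn S i)]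

/-- Annihilation operators anticommute. -/
theorem annih_annih (i j : ι) : annih i * annih j + annih j * annih i = 0 := by
  refine end_ext fun S => ?_
  by_cases hij : i = j
  · subst hij
    by_cases hi : i ∈ S <;> simp [annih_mono, hi]
  · by_cases hi : i ∈ S <;> by_cases hj : j ∈ S <;>
      simp [annih_mono, hi, hj, hij, Ne.symm hij, sgn_erase, smul_smul,
        Finset.erase_right_comm (a := i) (b := j)]
    rcases lt_or_gt_of_ne hij with h | h <;> simp [h, h.not_gt, mul_comm (sgn S i)]

/-- The anticommutator of an annihilation and a creation operator. -/
theorem annih_create (i j : ι) :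
    annih i * create j + create j * annih i = if i = j then 1 else 0 := by
  refine end_ext fun S => ?_
  by_cases hij : i = j
  · subst hij
    by_cases hi : i ∈ S
    · simp [annih_mono, create_mono, hi, smul_smul, sgn_erase, sgn_mul_self]
    · simp [annih_mono, create_mono, hi, smul_smul, sgn_insert, sgn_mul_self]
  · by_cases hi : i ∈ S <;> by_cases hj : j ∈ S <;>
      simp [annih_mono, create_mono, hi, hj, hij, Ne.symm hij, smul_smul, sgn_insert, sgn_erase]
    rw [Finset.erase_insert_of_ne (Ne.symm hij)]
    rcases lt_or_gt_of_ne hij with h | h <;> simp [h, h.not_gt, mul_comm (sgn S i)]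

/-- Annihilation operators kill the vacuum. -/
theorem annih_vac (i : ι) : annih i (vac : Fock ι) = 0 := by
  simp [vac, annih_mono]

/-- The vacuum generates the Fock space under the creation operators. -/
theorem eq_top_of_vac_mem (W : Submodule ℂ (Fock ι)) (h0 : vac ∈ W)
    (h : ∀ i, ∀ v ∈ W, create i v ∈ W) : W = ⊤ := by
  have key : ∀ S : Finset ι, mono S ∈ W := by
    intro S
    induction S using Finset.induction_on_max with
    | empty => exact h0
    | insert a S hlt ih =>
      have ha : a ∉ S := fun ha => lt_irrefl _ (hlt a ha)
      have : create a (mono S) = mono (insert a S) := by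
        have hs : S.filter (fun j => a < j) = ∅ := by
          refine Finset.filter_eq_empty_iff.2 fun j hj => (hlt j hj).not_gt
        simp [create_mono, ha, sgn, hs]
      exact this ▸ h a _ ih
  rw [eq_top_iff]
  intro v _
  have hv : v = v.sum fun S c => c • mono S := by
    conv_lhs => rw [← Finsupp.sum_single v]
    simp [mono]
  rw [hv]
  exact Submodule.sum_mem _ fun S _ => W.smul_mem _ (key S)

/-- A vector involves only finitely many indices. -/
theorem finite_annih (v : Fock ι) : {i | annih i v ≠ 0}.Finite := by
  refine Set.Finite.subset (v.support.biUnion id).finite_toSet fun i hi => ?_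
  by_contra hc
  refine hi ?_
  rw [annih, Finsupp.linearCombination_apply]
  refine Finset.sum_eq_zero fun S hS => ?_
  have : i ∉ S := fun h => hc (by
    simp only [Finset.coe_biUnion, Set.mem_iUnion]
    exact ⟨S, hS, h⟩)
  simp [this]

end Fock

/-! ### Fields and operations on fields -/

namespace FormalField

open HVertexOperator

variable {V : Type} [AddCommGroup V] [Module ℂ V]

theorem exists_bound (a : VertexOperator ℂ V) (v : V) : ∃ N : ℤ, ∀ m < N, coeff a m v = 0 :=
  ⟨_, fun _ h => VertexOperator.coeff_eq_zero_of_lt_order a _ v h⟩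

theorem bddBelow_of_bound {V : Type} [AddCommGroup V] {f : ℤ → V} (h : ∃ N : ℤ, ∀ m < N, f m = 0) :
    BddBelow (Function.support f) := by
  obtain ⟨N, hN⟩ := h
  exact ⟨N, fun m hm => not_lt.1 fun hlt => hm (hN m hlt)⟩

/-- The field `a(-z)`. -/
def reflect (a : VertexOperator ℂ V) : VertexOperator ℂ V :=
  VertexOperator.of_coeff (fun m => ((-1 : ℂ) ^ m) • coeff a m) fun v =>
    bddBelow_of_bound <| (exists_bound a v).imp fun N hN m hm => by
      rw [LinearMap.smul_apply, hN m hm, smul_zero]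

/-- The field `z ^ k * a(z)`. -/
def mulZ (k : ℤ) (a : VertexOperator ℂ V) : VertexOperator ℂ V :=
  VertexOperator.of_coeff (fun m => coeff a (m - k)) fun v =>
    bddBelow_of_bound <| (exists_bound a v).elim fun N hN =>
      ⟨N + k, fun m hm => hN _ (by lia)⟩

/-- The derivative `∂_z a(z)`. -/
def derivZ (a : VertexOperator ℂ V) : VertexOperator ℂ V :=
  VertexOperator.of_coeff (fun m => ((m : ℂ) + 1) • coeff a (m + 1)) fun v =>
    bddBelow_of_bound <| (exists_bound a v).elim fun N hN =>
      ⟨N - 1, fun m hm => by rw [LinearMap.smul_apply, hN _ (by lia), smul_zero]⟩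

/-- The derivative with respect to `z ^ 2`, that is `(2 z)⁻¹ ∂_z a(z)`. -/
def derivZSq (a : VertexOperator ℂ V) : VertexOperator ℂ V :=
  (1 / 2 : ℂ) • mulZ (-1) (derivZ a)

/-- The coefficient of `z ^ i * w ^ j` in the normal ordered product of two odd fields
`:a(z) b(w): = a(z)₊ b(w) - b(w) a(z)₋`, where `a(z)₊` collects the nonnegative and `a(z)₋` the
negative powers of `z` in `a(z)`. -/
def normalOrdCoeff (a b : VertexOperator ℂ V) (i j : ℤ) : Module.End ℂ V :=
  if 0 ≤ i then coeff a i * coeff b j else -(coeff b j * coeff a i)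

theorem normalOrd_bound (a b : VertexOperator ℂ V) (v : V) :
    ∃ N : ℤ, ∀ m < N, ∀ i, normalOrdCoeff a b i (m - i) v = 0 := by
  obtain ⟨Na, ha⟩ := exists_bound a v
  obtain ⟨Nb, hb⟩ := exists_bound b v
  choose Nc hc using fun i : ℤ => exists_bound b (coeff a i v)
  obtain ⟨K, hK⟩ := ((Set.finite_Ico Na 0).image fun i => Nc i + i).bddBelow
  refine ⟨min Nb K, fun m hm i => ?_⟩
  unfold normalOrdCoeff
  split_ifs with hi
  · rw [Module.End.mul_apply, hb _ (by lia), map_zero]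
  · rw [LinearMap.neg_apply, Module.End.mul_apply]
    by_cases hia : i < Na
    · rw [ha i hia, map_zero, neg_zero]
    · have : K ≤ Nc i + i := hK ⟨i, ⟨not_lt.1 hia, not_le.1 hi⟩, rfl⟩
      rw [hc i _ (by lia), neg_zero]

theorem normalOrd_finite (a b : VertexOperator ℂ V) (m : ℤ) (v : V) :
    (Function.support fun i => normalOrdCoeff a b i (m - i) v).Finite := by
  obtain ⟨Na, ha⟩ := exists_bound a v
  obtain ⟨Nb, hb⟩ := exists_bound b v
  refine (Set.finite_Icc (min Na 0) (m - Nb)).union (Set.finite_Ico Na 0) |>.subset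
    fun i hi => ?_
  by_contra hc
  simp only [Set.mem_union, Set.mem_Icc, Set.mem_Ico, not_or, not_and, not_le, not_lt] at hc
  refine hi ?_
  change normalOrdCoeff a b i (m - i) v = 0
  unfold normalOrdCoeff
  split_ifs with h
  · rw [Module.End.mul_apply, hb _ (by have := hc.1 (by lia); lia), map_zero]
  · rw [LinearMap.neg_apply, Module.End.mul_apply, ha i (by
      by_contra h'
      exact h (hc.2 (not_lt.1 h'))), map_zero, neg_zero]

/-- The normal ordered product `:a(z) b(z):` of two odd fields. The coefficient of `z ^ m`, applied
to a vector, is the sum (which has only finitely many nonzero terms) over all `i + j = m` of the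
coefficients of `z ^ i * w ^ j` in `:a(z) b(w):`. -/
def normalOrd (a b : VertexOperator ℂ V) : VertexOperator ℂ V :=
  VertexOperator.of_coeff
    (fun m =>
      { toFun := fun v => ∑ᶠ i : ℤ, normalOrdCoeff a b i (m - i) v
        map_add' := fun u v => by
          simp only [map_add]
          exact finsum_add_distrib (normalOrd_finite a b m u) (normalOrd_finite a b m v)
        map_smul' := fun c v => by
          simp only [map_smul, RingHom.id_apply]
          exact (smul_finsum' c (normalOrd_finite a b m v)).symm })
    fun v => bddBelow_of_bound <| (normalOrd_bound a b v).imp fun N hN m hm => by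
      simp [hN m hm]

theorem coeff_normalOrd (a b : VertexOperator ℂ V) (m : ℤ) (v : V) :
    coeff (normalOrd a b) m v = ∑ᶠ i : ℤ, normalOrdCoeff a b i (m - i) v := rfl

end FormalField

/-! ### The neutral fermion -/

open Fock FormalField HVertexOperator

/-- The Fock space `F^{⊗ 1/2}` of a single neutral fermion: the creation operator with index
`n : ℕ` is the mode `φ_{-n-1/2}`, the annihilation operator with index `n` is `φ_{n+1/2}`. -/
abbrev FockD : Type := Fock ℕ

/-- The coefficient `φ_{-m-1/2}` of `z ^ m` in the neutral fermion field. -/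
def phiCoeff (m : ℤ) : Module.End ℂ FockD :=
  if 0 ≤ m then create m.toNat else annih (-m - 1).toNat

/-- The defining relation `{φ_r, φ_s} = δ_{r,-s}` with `r = -m - 1/2` and `s = -n - 1/2`. -/
theorem phiCoeff_anticomm (m n : ℤ) :
    phiCoeff m * phiCoeff n + phiCoeff n * phiCoeff m = if m + n = -1 then 1 else 0 := by
  unfold phiCoeff
  split_ifs with hm hn h hn h h
  · lia
  · exact create_create _ _
  · rw [add_comm, annih_create, if_pos (by lia)]
  · rw [add_comm, annih_create, if_neg (by lia)]
  all_goals first | lia | skip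
  · rw [annih_create, if_pos (by lia)]
  · rw [annih_create, if_neg (by lia)]
  · exact annih_annih _ _

theorem phiCoeff_vac (m : ℤ) (hm : m < 0) : phiCoeff m vac = 0 := by
  rw [phiCoeff, if_neg (by lia), annih_vac]

theorem exists_annih_bound (v : FockD) : ∃ N : ℤ, ∀ m < N, phiCoeff m v = 0 := by
  obtain ⟨K, hK⟩ := (finite_annih v).bddAbove
  refine ⟨-K - 1, fun m hm => ?_⟩
  rw [phiCoeff, if_neg (by lia)]
  by_contra h
  have := hK h
  lia

/-- The neutral fermion field `φ^D(z) = ∑ φ_{-m-1/2} z ^ m`. -/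
def phiD : VertexOperator ℂ FockD :=
  VertexOperator.of_coeff phiCoeff fun v => bddBelow_of_bound (exists_annih_bound v)

/-- The degree `dg` of a monomial: the number of odd minus the number of even indices. -/
def dg (S : Finset ℕ) : ℤ :=
  ((S.filter (fun n => Odd n)).card : ℤ) - ((S.filter (fun n => Even n)).card : ℤ)

/-- The component `F_(m)`, spanned by the monomials of degree `m`. -/
def component (m : ℤ) : Submodule ℂ FockD :=
  Submodule.span ℂ (mono '' {S : Finset ℕ | dg S = m})

/-- The field `((-1)^k / (4 z)) :(φ(z) - φ(-z)) ∂_{z²}^k (φ(z) + φ(-z)):`. -/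
def currentD (k : ℕ) : VertexOperator ℂ FockD :=
  ((-1 : ℂ) ^ k / 4) •
    mulZ (-1) (normalOrd (phiD - reflect phiD) (derivZSq^[k] (phiD + reflect phiD)))

/-! ### The charged fermions -/

/-- The Fock space `F^{⊗ 1}` of a pair of charged fermions. The creation operator with index
`i : ℤ` is `ψ⁺_{-i-1}` if `i ≥ 0` and `ψ⁻_{i}` if `i < 0`; the annihilation operator with index `i`
is correspondingly `ψ⁻_{i}` if `i ≥ 0` and `ψ⁺_{-i-1}` if `i < 0`. -/
abbrev FockA : Type := Fock ℤ

/-- The mode `ψ⁺_n`. -/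
def psiPlusMode (n : ℤ) : Module.End ℂ FockA :=
  if n < 0 then create (-n - 1) else annih (-n - 1)

/-- The mode `ψ⁻_n`. -/
def psiMinusMode (n : ℤ) : Module.End ℂ FockA :=
  if n < 0 then create n else annih n

theorem psi_anticomm (m n : ℤ) :
    psiPlusMode m * psiMinusMode n + psiMinusMode n * psiPlusMode m
      = if m + n = -1 then 1 else 0 := by
  unfold psiPlusMode psiMinusMode
  by_cases hm : m < 0 <;> by_cases hn : n < 0 <;> simp only [hm, hn, if_true, if_false]
  · rw [create_create, if_neg (by lia)]
  · rw [add_comm, annih_create]; exact if_congr (by lia) rfl rfl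
  · rw [annih_create]; exact if_congr (by lia) rfl rfl
  · rw [annih_annih, if_neg (by lia)]

theorem psiPlus_anticomm (m n : ℤ) :
    psiPlusMode m * psiPlusMode n + psiPlusMode n * psiPlusMode m = 0 := by
  unfold psiPlusMode
  by_cases hm : m < 0 <;> by_cases hn : n < 0 <;> simp only [hm, hn, if_true, if_false]
  · exact create_create _ _
  · rw [add_comm, annih_create, if_neg (by lia)]
  · rw [annih_create, if_neg (by lia)]
  · exact annih_annih _ _

theorem psiMinus_anticomm (m n : ℤ) :
    psiMinusMode m * psiMinusMode n + psiMinusMode n * psiMinusMode m = 0 := by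
  unfold psiMinusMode
  by_cases hm : m < 0 <;> by_cases hn : n < 0 <;> simp only [hm, hn, if_true, if_false]
  · exact create_create _ _
  · rw [add_comm, annih_create, if_neg (by lia)]
  · rw [annih_create, if_neg (by lia)]
  · exact annih_annih _ _

theorem psi_vac (n : ℤ) (hn : 0 ≤ n) : psiPlusMode n vac = 0 ∧ psiMinusMode n vac = 0 := by
  simp [psiPlusMode, psiMinusMode, hn.not_gt, annih_vac]

theorem exists_psi_bound (v : FockA) :
    ∃ N : ℤ, ∀ m < N, psiPlusMode (-m - 1) v = 0 ∧ psiMinusMode (-m - 1) v = 0 := by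
  obtain ⟨K, hK⟩ := (finite_annih v).bddAbove
  obtain ⟨K', hK'⟩ := (finite_annih v).bddBelow
  refine ⟨min (min (-K - 1) K') 0, fun m hm => ?_⟩
  rw [psiPlusMode, psiMinusMode, if_neg (by lia), if_neg (by lia)]
  constructor <;> by_contra h
  · have := hK' h
    lia
  · have := hK h
    lia

/-- The charged fermion field `ψ⁺(z) = ∑ ψ⁺_n z ^ (-n-1)`. -/
def psiPlus : VertexOperator ℂ FockA :=
  VertexOperator.of_coeff (fun m => psiPlusMode (-m - 1)) fun v =>
    bddBelow_of_bound ((exists_psi_bound v).imp fun _ h m hm => (h m hm).1)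

/-- The charged fermion field `ψ⁻(z) = ∑ ψ⁻_n z ^ (-n-1)`. -/
def psiMinus : VertexOperator ℂ FockA :=
  VertexOperator.of_coeff (fun m => psiMinusMode (-m - 1)) fun v =>
    bddBelow_of_bound ((exists_psi_bound v).imp fun _ h m hm => (h m hm).2)

/-- The field `(-1)^k :ψ⁺(z) ∂_z^k ψ⁻(z):`. -/
def currentA (k : ℕ) : VertexOperator ℂ FockA :=
  ((-1 : ℂ) ^ k) • normalOrd psiPlus (derivZ^[k] psiMinus)

/-! ### Differential operators on the circle -/

namespace DiffCircle

open LaurentPolynomial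

/-- Multiplication by a Laurent polynomial. -/
def mulOp (a : ℂ[T;T⁻¹]) : Module.End ℂ ℂ[T;T⁻¹] := LinearMap.mulLeft ℂ a

/-- The linear operator with prescribed values on the powers `t ^ j`. -/
def ofValues (g : ℤ → ℂ[T;T⁻¹]) : Module.End ℂ ℂ[T;T⁻¹] where
  toFun p := p.coeff.sum fun j c => c • g j
  map_add' p q := by
    rw [AddMonoidAlgebra.coeff_add, Finsupp.sum_add_index'] <;> simp [add_smul]
  map_smul' c p := by
    rw [AddMonoidAlgebra.coeff_smul, Finsupp.sum_smul_index'] <;>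
      simp [Finsupp.smul_sum, smul_smul]

theorem ofValues_T (g : ℤ → ℂ[T;T⁻¹]) (j : ℤ) : ofValues g (T j) = g j := by
  change (Finsupp.single j (1 : ℂ)).sum (fun j c => c • g j) = g j
  simp

theorem end_ext {A B : Module.End ℂ ℂ[T;T⁻¹]} (h : ∀ j, A (T j) = B (T j)) : A = B := by
  refine LinearMap.ext fun p => ?_
  induction p using LaurentPolynomial.induction_on' with
  | add p q hp hq => rw [map_add, map_add, hp, hq]
  | C_mul_T n a => rw [← smul_eq_C_mul, map_smul, map_smul, h]

/-- The derivation `∂_t`. -/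
def derivT : Module.End ℂ ℂ[T;T⁻¹] := ofValues fun j => (j : ℂ) • T (j - 1)

theorem derivT_T (j : ℤ) : derivT (T j) = (j : ℂ) • T (j - 1) := ofValues_T _ j

/-- The associative algebra of differential operators `∑ a_j(t) ∂_t ^ j` on the circle, with Laurent
polynomial coefficients. -/
def diffAlg : Subalgebra ℂ (Module.End ℂ ℂ[T;T⁻¹]) :=
  Algebra.adjoin ℂ (Set.range mulOp ∪ {derivT})

/-- The Lie algebra `𝒟 = Diff ℂ^*` of differential operators, with the commutator bracket. -/
def diffOp : LieSubalgebra ℂ (Module.End ℂ ℂ[T;T⁻¹]) where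
  toSubmodule := Subalgebra.toSubmodule diffAlg
  lie_mem' := fun hx hy =>
    diffAlg.sub_mem (diffAlg.mul_mem hx hy) (diffAlg.mul_mem hy hx)

theorem mulOp_mem (a : ℂ[T;T⁻¹]) : mulOp a ∈ diffAlg :=
  Algebra.subset_adjoin (Or.inl ⟨a, rfl⟩)

theorem derivT_mem : derivT ∈ diffAlg := Algebra.subset_adjoin (Or.inr rfl)

/-- The differential operator `J^k_n = t ^ (n + k) (-∂_t) ^ k`. -/
def jOp (k : ℕ) (n : ℤ) : diffOp :=
  ⟨mulOp (T (n + k)) * (-derivT) ^ k,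
    diffAlg.mul_mem (mulOp_mem _) (pow_mem (neg_mem derivT_mem) k)⟩

/-- The matrix coefficient of an operator: the coefficient of `t ^ i` in `A t ^ j`. -/
def mat (A : Module.End ℂ ℂ[T;T⁻¹]) (i j : ℤ) : ℂ := (A (T j)).coeff i

theorem mat_ext {A B : Module.End ℂ ℂ[T;T⁻¹]} (h : ∀ i j, mat A i j = mat B i j) : A = B :=
  end_ext fun j => LaurentPolynomial.ext fun i => h i j

/-- The operator `t ^ r f(t ∂_t)`, which maps `t ^ j` to `f(j) t ^ (j + r)`. -/
def homog (r : ℤ) : ℂ[X] →ₗ[ℂ] Module.End ℂ ℂ[T;T⁻¹] where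
  toFun f := ofValues fun j => f.eval (j : ℂ) • T (j + r)
  map_add' f g := end_ext fun j => by simp [ofValues_T, add_smul]
  map_smul' c f := end_ext fun j => by simp [ofValues_T, smul_smul]

theorem homog_T (r : ℤ) (f : ℂ[X]) (j : ℤ) : homog r f (T j) = f.eval (j : ℂ) • T (j + r) :=
  ofValues_T _ j

theorem homog_mul (r s : ℤ) (f g : ℂ[X]) :
    homog r f * homog s g = homog (r + s) (Polynomial.taylor (s : ℂ) f * g) := by
  refine end_ext fun j => ?_
  simp [Polynomial.taylor_eval, Module.End.mul_apply, homog_T, smul_smul, mul_comm, add_assoc, add_comm s r]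

theorem mulOp_T (r : ℤ) : mulOp (T r) = homog r 1 := by
  refine end_ext fun j => ?_
  simp only [mulOp, LinearMap.mulLeft_apply, homog_T, Polynomial.eval_one, one_smul]
  rw [← T_add, add_comm]

theorem derivT_eq : derivT = homog (-1) Polynomial.X := by
  refine end_ext fun j => ?_
  simp [derivT_T, homog_T, sub_eq_add_neg]

theorem homog_mem (r : ℤ) (f : ℂ[X]) : homog r f ∈ diffAlg := by
  have h1 : ∀ r, homog r 1 ∈ diffAlg := fun r => mulOp_T r ▸ mulOp_mem _
  have hX : homog 0 Polynomial.X ∈ diffAlg := by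
    have : homog 0 Polynomial.X = homog 1 1 * derivT := by
      rw [derivT_eq, homog_mul]; simp
    exact this ▸ mul_mem (h1 1) derivT_mem
  have h0 : ∀ f, homog 0 f ∈ diffAlg := by
    intro f
    induction f using Polynomial.induction_on' with
    | add p q hp hq => rw [map_add]; exact add_mem hp hq
    | monomial n a =>
      rw [← mul_one a, ← smul_eq_mul, ← Polynomial.smul_monomial, map_smul]
      refine Subalgebra.smul_mem _ ?_ a
      rw [← Polynomial.X_pow_eq_monomial]
      induction n with
      | zero => exact h1 0
      | succ n ih =>
        have : homog 0 (Polynomial.X ^ (n + 1)) = homog 0 (Polynomial.X ^ n) * homog 0 Polynomial.X := by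
          rw [homog_mul]; simp [pow_succ]
        exact this ▸ mul_mem ih hX
  have : homog r f = homog r 1 * homog 0 f := by rw [homog_mul]; simp
  exact this ▸ mul_mem (h1 r) (h0 f)

/-- The linear map assembling a differential operator from its homogeneous components. -/
def assemble : (ℤ →₀ ℂ[X]) →ₗ[ℂ] Module.End ℂ ℂ[T;T⁻¹] := Finsupp.lsum ℂ homog

theorem assemble_single (r : ℤ) (f : ℂ[X]) : assemble (Finsupp.single r f) = homog r f := by
  simp [assemble]

theorem mat_homog (r : ℤ) (f : ℂ[X]) (i j : ℤ) :
    mat (homog r f) i j = if i = j + r then f.eval (j : ℂ) else 0 := by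
  simp [mat, homog_T, eq_comm]

theorem mat_add (A B : Module.End ℂ ℂ[T;T⁻¹]) (i j : ℤ) :
    mat (A + B) i j = mat A i j + mat B i j := by simp [mat]

theorem mat_smul (c : ℂ) (A : Module.End ℂ ℂ[T;T⁻¹]) (i j : ℤ) :
    mat (c • A) i j = c * mat A i j := by simp [mat]

theorem mat_assemble (F : ℤ →₀ ℂ[X]) (i j : ℤ) :
    mat (assemble F) i j = (F (i - j)).eval (j : ℂ) := by
  induction F using Finsupp.induction_linear with
  | zero => simp [mat]
  | add F G hF hG => simp [mat_add, hF, hG]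
  | single r f =>
    rw [assemble_single, mat_homog, Finsupp.single_apply]
    by_cases h : i = j + r
    · rw [if_pos h, if_pos (by lia)]
    · rw [if_neg h, if_neg (by lia), Polynomial.eval_zero]

theorem assemble_injective : Function.Injective assemble := by
  intro F G h
  ext1 r
  refine Polynomial.eq_of_infinite_eval_eq _ _ ?_
  refine Set.Infinite.mono ?_ (Set.infinite_range_of_injective (Int.cast_injective (α := ℂ)))
  rintro _ ⟨j, rfl⟩
  have := mat_assemble F (j + r) j
  rw [h, mat_assemble] at this
  simpa using this.symm

theorem mem_diffOp_iff (A : Module.End ℂ ℂ[T;T⁻¹]) : A ∈ diffOp ↔ ∃ F, assemble F = A := by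
  constructor
  · intro hA
    have hmul : ∀ F G, ∃ H, assemble H = assemble F * assemble G := by
      intro F G
      induction F using Finsupp.induction_linear with
      | zero => exact ⟨0, by simp⟩
      | add F F' hF hF' =>
        obtain ⟨H, hH⟩ := hF
        obtain ⟨H', hH'⟩ := hF'
        exact ⟨H + H', by rw [map_add, map_add, hH, hH', add_mul]⟩
      | single r f =>
        induction G using Finsupp.induction_linear with
        | zero => exact ⟨0, by simp⟩
        | add F F' hF hF' =>
          obtain ⟨H, hH⟩ := hF
          obtain ⟨H', hH'⟩ := hF'
          exact ⟨H + H', by rw [map_add, map_add, hH, hH', mul_add]⟩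
        | single s g =>
          exact ⟨Finsupp.single (r + s) _, by
            rw [assemble_single, assemble_single, assemble_single, homog_mul]⟩
    change A ∈ Algebra.adjoin ℂ _ at hA
    induction hA using Algebra.adjoin_induction with
    | mem x hx =>
      rcases hx with ⟨a, rfl⟩ | rfl
      · induction a using LaurentPolynomial.induction_on' with
        | add p q hp hq =>
          obtain ⟨H, hH⟩ := hp
          obtain ⟨H', hH'⟩ := hq
          exact ⟨H + H', by rw [map_add, hH, hH']; ext; simp [mulOp, add_mul]⟩
        | C_mul_T n c =>
          refine ⟨c • Finsupp.single n 1, ?_⟩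
          rw [map_smul, assemble_single, ← mulOp_T]
          refine LinearMap.ext fun p => ?_
          change c • (T n * p) = C c * T n * p
          rw [smul_eq_C_mul, mul_assoc]
      · exact ⟨Finsupp.single (-1) Polynomial.X, by rw [assemble_single, derivT_eq]⟩
    | algebraMap c =>
      refine ⟨c • Finsupp.single 0 1, ?_⟩
      rw [map_smul, assemble_single, ← mulOp_T, Algebra.algebraMap_eq_smul_one]
      ext; simp [mulOp]
    | add x y _ _ hx hy =>
      obtain ⟨H, rfl⟩ := hx
      obtain ⟨H', rfl⟩ := hy
      exact ⟨H + H', map_add _ _ _⟩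
    | mul x y _ _ hx hy =>
      obtain ⟨H, rfl⟩ := hx
      obtain ⟨H', rfl⟩ := hy
      exact hmul H H'
  · rintro ⟨F, rfl⟩
    rw [assemble, Finsupp.lsum_apply]
    exact diffOp.toSubmodule.sum_mem fun r _ => homog_mem r _

/-- A differential operator, decomposed into homogeneous components `t ^ r f(t ∂_t)`. -/
def components : (ℤ →₀ ℂ[X]) ≃ₗ[ℂ] diffOp :=
  LinearEquiv.ofBijective (assemble.codRestrict diffOp.toSubmodule fun F =>
      (mem_diffOp_iff _).2 ⟨F, rfl⟩)
    ⟨fun F G h => assemble_injective (congrArg Subtype.val h), fun A => by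
      obtain ⟨F, hF⟩ := (mem_diffOp_iff _).1 A.2
      exact ⟨F, Subtype.ext hF⟩⟩

/-! ### The two-cocycle -/

/-- The indicator function of the nonnegative integers. -/
def chi (i : ℤ) : ℂ := if 0 ≤ i then 1 else 0

/-- The cocycle `Ψ(A, B) = ∑ (A_{ij} B_{ji} - B_{ij} A_{ji})`, summed over `i ≥ 0 > j`; only finitely
many terms are nonzero. -/
def psiFun (A B : Module.End ℂ ℂ[T;T⁻¹]) : ℂ :=
  ∑ᶠ p : ℤ × ℤ, if 0 ≤ p.1 ∧ p.2 < 0 then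
    mat A p.1 p.2 * mat B p.2 p.1 - mat B p.1 p.2 * mat A p.2 p.1 else 0

/-- The matrix of `A` is supported in a band of width `w` around the diagonal. -/
def Banded (w : ℤ) (A : Module.End ℂ ℂ[T;T⁻¹]) : Prop :=
  ∀ i j, w < i - j ∨ w < j - i → mat A i j = 0

theorem exists_banded (A : diffOp) : ∃ w, 0 ≤ w ∧ Banded w A.1 := by
  obtain ⟨F, hF⟩ := (mem_diffOp_iff _).1 A.2
  obtain ⟨w, hw⟩ := (F.support.image fun r => |r|).bddAbove
  refine ⟨max w 0, le_max_right _ _, fun i j h => ?_⟩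
  rw [← hF, mat_assemble]
  by_cases hr : F (i - j) = 0
  · simp [hr]
  · have h1 : |i - j| ≤ w := hw (by
      simp only [Finset.coe_image, Set.mem_image, Finset.mem_coe, Finsupp.mem_support_iff]
      exact ⟨_, hr, rfl⟩)
    have h2 := abs_le.1 h1
    lia

theorem Banded.mono {w w' : ℤ} {A : Module.End ℂ ℂ[T;T⁻¹]} (h : Banded w A) (hw : w ≤ w') :
    Banded w' A := fun i j hij => h i j (by lia)

theorem psiFun_eq {w M : ℤ} {A : Module.End ℂ ℂ[T;T⁻¹]} (B : Module.End ℂ ℂ[T;T⁻¹])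
    (hA : Banded w A) (hM : w ≤ M) :
    psiFun A B = ∑ i ∈ Finset.Icc (-M) M, ∑ j ∈ Finset.Icc (-M) M,
      (chi i - chi j) * mat A i j * mat B j i := by
  have h1 : psiFun A B = ∑ p ∈ Finset.Icc (-M) M ×ˢ Finset.Icc (-M) M,
      if 0 ≤ p.1 ∧ p.2 < 0 then
        mat A p.1 p.2 * mat B p.2 p.1 - mat B p.1 p.2 * mat A p.2 p.1 else 0 := by
    refine finsum_eq_sum_of_support_subset _ ?_
    rintro ⟨i, j⟩ hp
    simp only [Function.mem_support] at hp
    split_ifs at hp with hs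
    · by_contra hc
      simp only [Finset.coe_product, Finset.coe_Icc, Set.mem_prod, Set.mem_Icc, not_and_or,
        not_le] at hc
      refine hp ?_
      rw [hA _ _ (by lia), hA _ _ (by lia)]
      ring
    · exact absurd rfl hp
  rw [h1, Finset.sum_product]
  have h2 : ∀ i j : ℤ, (if 0 ≤ i ∧ j < 0 then
        mat A i j * mat B j i - mat B i j * mat A j i else 0)
      = (if 0 ≤ i ∧ j < 0 then mat A i j * mat B j i else 0)
        - (if 0 ≤ i ∧ j < 0 then mat B i j * mat A j i else 0) := by
    intro i j; split_ifs <;> ring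
  have h3 : ∀ i j : ℤ, (chi i - chi j) * mat A i j * mat B j i
      = (if 0 ≤ i ∧ j < 0 then mat A i j * mat B j i else 0)
        - (if 0 ≤ j ∧ i < 0 then mat B j i * mat A i j else 0) := by
    intro i j
    unfold chi
    by_cases hi : 0 ≤ i <;> by_cases hj : 0 ≤ j <;> simp [hi, hj, not_le.1, not_lt.2]
    all_goals simp [mul_comm]
  simp only [h2, h3, Finset.sum_sub_distrib]
  congr 1
  exact Finset.sum_comm

theorem mat_mul {w M : ℤ} {A B : Module.End ℂ ℂ[T;T⁻¹]} (hA : Banded w A) {i j : ℤ}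
    (hM : i + w ≤ M) (hM' : -M ≤ i - w) :
    mat (A * B) i j = ∑ k ∈ Finset.Icc (-M) M, mat A i k * mat B k j := by
  have key : ∀ p : ℂ[T;T⁻¹], (A p).coeff i = ∑ k ∈ Finset.Icc (-M) M, mat A i k * p.coeff k := by
    intro p
    induction p using LaurentPolynomial.induction_on' with
    | add p q hp hq => simp [hp, hq, mul_add, Finset.sum_add_distrib]
    | C_mul_T n a =>
      have : ∀ k, (C a * T n : ℂ[T;T⁻¹]).coeff k = if n = k then a else 0 := by
        intro k; rw [← smul_eq_C_mul]; simp
      simp only [this, mul_ite, mul_zero, Finset.sum_ite_eq]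
      rw [← smul_eq_C_mul, map_smul]
      change a * mat A i n = _
      split_ifs with h
      · ring
      · rw [hA i n (by
          simp only [Finset.mem_Icc, not_and_or, not_le] at h
          lia), mul_zero]
  exact key (B (T j))

theorem Banded.mul {w w' : ℤ} {A B : Module.End ℂ ℂ[T;T⁻¹]} (hA : Banded w A)
    (hB : Banded w' B) : Banded (w + w') (A * B) := by
  intro i j hij
  rw [mat_mul (M := max (i + w) (w - i)) hA (by lia) (by lia)]
  refine Finset.sum_eq_zero fun k _ => ?_
  by_cases h : w < i - k ∨ w < k - i
  · rw [hA _ _ h, zero_mul]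
  · rw [hB k j (by lia), mul_zero]

theorem psiFun_cyclic {w : ℤ} (hw : 0 ≤ w) {A B D : Module.End ℂ ℂ[T;T⁻¹]} (hA : Banded w A)
    (hB : Banded w B) (hD : Banded w D) :
    psiFun (A * B) D + psiFun (B * D) A + psiFun (D * A) B = 0 := by
  have e : ∀ A B D : Module.End ℂ ℂ[T;T⁻¹], Banded w A → Banded w B → Banded w D →
      psiFun (A * B) D = ∑ i ∈ Finset.Icc (-(4 * w)) (4 * w), ∑ k ∈ Finset.Icc (-(4 * w)) (4 * w),
        ∑ j ∈ Finset.Icc (-(4 * w)) (4 * w),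
        (chi i - chi j) * mat A i k * mat B k j * mat D j i := by
    intro A B D hA hB hD
    rw [psiFun_eq (M := 4 * w) D (hA.mul hB) (by lia)]
    refine Finset.sum_congr rfl fun i hi => ?_
    rw [Finset.sum_comm (s := Finset.Icc (-(4 * w)) (4 * w))]
    refine Finset.sum_congr rfl fun j hj => ?_
    by_cases hs : chi i = chi j
    · simp [hs]
    by_cases hji : w < j - i ∨ w < i - j
    · simp [hD _ _ hji]
    · have hi' : -w ≤ i ∧ i ≤ w := by
        by_contra hc
        refine hs ?_
        unfold chi
        by_cases h0 : 0 ≤ i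
        · rw [if_pos h0, if_pos (by lia)]
        · rw [if_neg h0, if_neg (by lia)]
      rw [mat_mul (M := 4 * w) hA (by lia) (by lia), Finset.mul_sum, Finset.sum_mul]
      exact Finset.sum_congr rfl fun k _ => by ring
  rw [e A B D hA hB hD, e B D A hB hD hA, e D A B hD hA hB]
  set I := Finset.Icc (-(4 * w)) (4 * w)
  have c1 : (∑ i ∈ I, ∑ k ∈ I, ∑ j ∈ I, (chi i - chi j) * mat B i k * mat D k j * mat A j i)
      = ∑ i ∈ I, ∑ k ∈ I, ∑ j ∈ I, (chi k - chi i) * mat B k j * mat D j i * mat A i k := by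
    rw [Finset.sum_comm]
    conv_rhs => rw [Finset.sum_comm]
    rw [Finset.sum_comm]
    refine Finset.sum_congr rfl fun k _ => ?_
    exact Finset.sum_comm
  have c2 : (∑ i ∈ I, ∑ k ∈ I, ∑ j ∈ I, (chi i - chi j) * mat D i k * mat A k j * mat B j i)
      = ∑ i ∈ I, ∑ k ∈ I, ∑ j ∈ I, (chi j - chi k) * mat D j i * mat A i k * mat B k j := by
    rw [Finset.sum_comm]
    refine Finset.sum_congr rfl fun k _ => ?_
    exact Finset.sum_comm
  rw [c1, c2]
  simp only [← Finset.sum_add_distrib]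
  refine Finset.sum_eq_zero fun i _ => Finset.sum_eq_zero fun k _ =>
    Finset.sum_eq_zero fun j _ => by ring

theorem psiFun_swap (A B : Module.End ℂ ℂ[T;T⁻¹]) : psiFun A B = -psiFun B A := by
  unfold psiFun
  rw [← finsum_neg_distrib]
  refine finsum_congr fun p => ?_
  split_ifs <;> ring

theorem psiFun_add_right (A : diffOp) (B B' : Module.End ℂ ℂ[T;T⁻¹]) :
    psiFun A (B + B') = psiFun A B + psiFun A B' := by
  obtain ⟨w, _, hA⟩ := exists_banded A
  simp only [psiFun_eq _ hA le_rfl, mat_add, mul_add, Finset.sum_add_distrib]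

theorem psiFun_smul_right (A : diffOp) (c : ℂ) (B : Module.End ℂ ℂ[T;T⁻¹]) :
    psiFun A (c • B) = c * psiFun A B := by
  obtain ⟨w, _, hA⟩ := exists_banded A
  simp only [psiFun_eq _ hA le_rfl, mat_smul, Finset.mul_sum]
  exact Finset.sum_congr rfl fun i _ => Finset.sum_congr rfl fun j _ => by ring

/-- `Ψ` as a bilinear form on the differential operators. -/
def psiBilin : diffOp →ₗ[ℂ] diffOp →ₗ[ℂ] ℂ :=
  LinearMap.mk₂ ℂ (fun A B => psiFun A B)
    (fun A A' B => by
      rw [psiFun_swap, psiFun_swap A.1, psiFun_swap A'.1, ← neg_add]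
      exact congrArg _ (psiFun_add_right B A.1 A'.1))
    (fun c A B => by
      rw [psiFun_swap, psiFun_swap A.1, smul_neg]
      exact congrArg _ (psiFun_smul_right B c A.1))
    (fun A B B' => psiFun_add_right A B.1 B'.1)
    (fun c A B => psiFun_smul_right A c B.1)

theorem psiBilin_apply (A B : diffOp) : psiBilin A B = psiFun A.1 B.1 := rfl

theorem psiBilin_swap (A B : diffOp) : psiBilin A B = -psiBilin B A := psiFun_swap _ _

theorem psiBilin_jacobi (A B D : diffOp) :
    psiBilin A ⁅B, D⁆ = psiBilin ⁅A, B⁆ D + psiBilin B ⁅A, D⁆ := by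
  obtain ⟨wa, ha0, ha⟩ := exists_banded A
  obtain ⟨wb, hb0, hb⟩ := exists_banded B
  obtain ⟨wd, hd0, hd⟩ := exists_banded D
  have ha' := ha.mono (show wa ≤ wa + wb + wd by lia)
  have hb' := hb.mono (show wb ≤ wa + wb + wd by lia)
  have hd' := hd.mono (show wd ≤ wa + wb + wd by lia)
  have h1 := psiFun_cyclic (by lia) ha' hb' hd'
  have h2 := psiFun_cyclic (by lia) hb' ha' hd'
  have hsub : ∀ X Y Z : diffOp, psiBilin ⁅X, Y⁆ Z
      = psiFun (X.1 * Y.1) Z.1 - psiFun (Y.1 * X.1) Z.1 := by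
    intro X Y Z
    change psiFun (X.1 * Y.1 - Y.1 * X.1) Z.1 = _
    rw [psiFun_swap, psiFun_swap (X.1 * Y.1), psiFun_swap (Y.1 * X.1), sub_eq_add_neg,
      ← neg_one_smul ℂ (Y.1 * X.1), psiFun_add_right, psiFun_smul_right]
    ring
  rw [psiBilin_swap A ⁅B, D⁆, psiBilin_swap B ⁅A, D⁆, hsub, hsub, hsub]
  linear_combination h2 - h1

open LieModule.Cohomology in
/-- `Ψ` as a Lie algebra two-cocycle with trivial coefficients. -/
def psiCocycle : twoCocycle ℂ diffOp (TrivialLieModule ℂ diffOp ℂ) where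
  val := ⟨psiBilin.compr₂ (TrivialLieModule.equiv ℂ diffOp ℂ).symm, fun A => by
    have : psiBilin A A = 0 := self_eq_neg.1 (psiBilin_swap A A)
    simp [this]⟩
  property := by
    rw [mem_twoCocycle_iff_of_trivial]
    intro A B D
    exact psiBilin_jacobi A B D

/-- The value of the cocycle on homogeneous elements `t ^ r f(t ∂_t)` and `t ^ s g(t ∂_t)`. -/
theorem psiFun_homog (r : ℕ) (s : ℤ) (f g : ℂ[X]) :
    psiFun (homog r f) (homog s g) = if (r : ℤ) + s = 0 then
      ∑ j ∈ Finset.Ico (-(r : ℤ)) 0, f.eval (j : ℂ) * g.eval ((j : ℂ) + r) else 0 := by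
  have hb : Banded (r : ℤ) (homog r f) := fun i j h => by
    rw [mat_homog, if_neg]
    lia
  have hval : ∀ p : ℤ × ℤ, (if 0 ≤ p.1 ∧ p.2 < 0 then
      mat (homog r f) p.1 p.2 * mat (homog s g) p.2 p.1
        - mat (homog s g) p.1 p.2 * mat (homog r f) p.2 p.1 else 0) =
      if p.1 = p.2 + r ∧ (r : ℤ) + s = 0 ∧ p.2 ∈ Finset.Ico (-(r : ℤ)) 0 then
        f.eval (p.2 : ℂ) * g.eval ((p.2 : ℂ) + r) else 0 := by
    rintro ⟨i, j⟩
    simp only [mat_homog, Finset.mem_Ico]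
    by_cases h : i = j + r ∧ (r : ℤ) + s = 0 ∧ (-(r : ℤ) ≤ j ∧ j < 0)
    · obtain ⟨h1, h2, h3, h4⟩ := h
      have h5 : (if j = i + (r : ℤ) then f.eval (i : ℂ) else 0) = 0 := if_neg (by lia)
      rw [if_pos (⟨by lia, h4⟩ : 0 ≤ i ∧ j < 0), if_pos h1, if_pos (by lia : j = i + s),
        if_pos (⟨h1, h2, h3, h4⟩ : i = j + r ∧ (r : ℤ) + s = 0 ∧ (-(r : ℤ) ≤ j ∧ j < 0)), h5, h1]
      push_cast
      ring
    · rw [if_neg h]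
      split_ifs <;> first | lia | simp
  rw [psiFun, finsum_congr hval]
  split_ifs with hrs
  · rw [finsum_eq_sum_of_support_subset (s := (Finset.Ico (-(r : ℤ)) 0).image fun j : ℤ => (j + (r : ℤ), j))]
    · rw [Finset.sum_image (by intro a _ b _ h; exact congrArg Prod.snd h)]
      refine Finset.sum_congr rfl fun j hj => ?_
      rw [if_pos ⟨rfl, hrs, hj⟩]
    · rintro ⟨i, j⟩ hp
      simp only [Function.mem_support] at hp
      split_ifs at hp with h
      · simp only [Finset.coe_image, Set.mem_image]
        exact ⟨j, h.2.2, by rw [h.1]⟩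
      · exact absurd rfl hp
  · simp [hrs]

end DiffCircle

/-- The Lie algebra `𝒟̂ = W_{1+∞}`: the central extension `𝒟 ⊕ ℂ C` of `𝒟` with bracket
`[A + a C, B + b C] = [A, B] + Ψ(A, B) C`. -/
abbrev DHat : Type := LieAlgebra.ofTwoCocycle DiffCircle.psiCocycle

namespace DHat

open DiffCircle

/-- The projection onto `𝒟`. -/
def proj : DHat →ₗ⁅ℂ⁆ diffOp where
  toFun x := x.carrier.1
  map_add' _ _ := rfl
  map_smul' _ _ := rfl
  map_lie' := rfl

/-- The element of `𝒟̂ = 𝒟 ⊕ ℂ C` corresponding to a differential operator. -/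
def lift : diffOp →ₗ[ℂ] DHat where
  toFun A := ⟨(A, 0)⟩
  map_add' _ _ := congrArg LieAlgebra.ofTwoCocycle.mk
    (Prod.ext rfl (add_zero (0 : TrivialLieModule ℂ diffOp ℂ)).symm)
  map_smul' c _ := congrArg LieAlgebra.ofTwoCocycle.mk
    (Prod.ext rfl (smul_zero (A := TrivialLieModule ℂ diffOp ℂ) c).symm)

/-- The central element `C`. -/
def central : DHat := ⟨(0, (1 : ℂ))⟩

/-- The element `J^k_n` of `𝒟̂`. -/
def J (k : ℕ) (n : ℤ) : DHat := lift (jOp k n)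

theorem mk_eq (A : diffOp) (c : ℂ) : (⟨(A, c)⟩ : DHat) = lift A + c • central := by
  refine congrArg LieAlgebra.ofTwoCocycle.mk (Prod.ext ?_ ?_)
  · change A = A + c • 0
    rw [smul_zero, add_zero]
  · change c = 0 + c • (1 : ℂ)
    simp

theorem lie_mk (A B : diffOp) (a b : ℂ) :
    ⁅(⟨(A, a)⟩ : DHat), (⟨(B, b)⟩ : DHat)⁆ = ⟨(⁅A, B⁆, psiFun A B)⟩ := by
  refine congrArg LieAlgebra.ofTwoCocycle.mk (Prod.ext rfl ?_)
  change psiFun A B + 0 - 0 = psiFun A B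
  ring

theorem lie_lift (A B : diffOp) : ⁅lift A, lift B⁆ = lift ⁅A, B⁆ + psiFun A B • central := by
  rw [← mk_eq]; exact lie_mk A B 0 0

end DHat

/-! ### The central extension is universal -/

/-- A homomorphism of Lie algebras is a central extension if it is surjective with central
kernel. -/
def IsCentralExtension {E L : Type*} [LieRing E] [LieAlgebra ℂ E] [LieRing L] [LieAlgebra ℂ L]
    (p : E →ₗ⁅ℂ⁆ L) : Prop :=
  Function.Surjective p ∧ ∀ x : E, p x = 0 → ∀ y : E, ⁅x, y⁆ = 0

/-- A central extension is universal if it maps uniquely to every other central extension. -/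
def IsUniversalCentralExtension.{u, v, w} {E : Type u} {L : Type v} [LieRing E] [LieAlgebra ℂ E]
    [LieRing L] [LieAlgebra ℂ L] (p : E →ₗ⁅ℂ⁆ L) : Prop :=
  IsCentralExtension p ∧
    ∀ (E' : Type w) [LieRing E'] [LieAlgebra ℂ E'] (q : E' →ₗ⁅ℂ⁆ L), IsCentralExtension q →
      ∃! f : E →ₗ⁅ℂ⁆ E', ∀ x, q (f x) = p x

namespace DiffCircle

open Polynomial (taylor)

/-- The homogeneous differential operator `t ^ r f(t ∂_t)`. -/
def hom (r : ℤ) : ℂ[X] →ₗ[ℂ] diffOp :=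
  (homog r).codRestrict diffOp.toSubmodule (homog_mem r)

theorem lie_hom (r s : ℤ) (f g : ℂ[X]) :
    ⁅hom r f, hom s g⁆ = hom (r + s) (taylor (s : ℂ) f * g - f * taylor (r : ℂ) g) := by
  refine Subtype.ext ?_
  change homog r f * homog s g - homog s g * homog r f = homog (r + s) _
  rw [homog_mul, homog_mul, add_comm s r, ← map_sub, mul_comm f]

theorem components_single (r : ℤ) (f : ℂ[X]) : components (Finsupp.single r f) = hom r f :=
  Subtype.ext (assemble_single r f)

theorem diffOp_induction {P : diffOp → Prop} (h0 : P 0) (hadd : ∀ A B, P A → P B → P (A + B))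
    (hhom : ∀ r f, P (hom r f)) (A : diffOp) : P A := by
  obtain ⟨F, rfl⟩ := components.surjective A
  induction F using Finsupp.induction_linear with
  | zero => simpa using h0
  | add F G hF hG => rw [map_add]; exact hadd _ _ hF hG
  | single r f => rw [components_single]; exact hhom r f

/-- The difference operator `f(x) ↦ f(x) - f(x + a)`. -/
def diff (a : ℂ) : ℂ[X] →ₗ[ℂ] ℂ[X] := LinearMap.id - taylor a

theorem diff_apply (a : ℂ) (f : ℂ[X]) : diff a f = f - taylor a f := rfl

theorem degree_diff_le (a : ℂ) (f : ℂ[X]) : (diff a f).degree ≤ f.degree := by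
  rw [diff_apply]
  exact (Polynomial.degree_sub_le _ _).trans (by simp)

theorem degree_diff_lt (a : ℂ) {f : ℂ[X]} (hf : f ≠ 0) : (diff a f).degree < f.degree := by
  rw [diff_apply]
  exact Polynomial.degree_sub_lt_left (by simp) hf (by simp)

theorem diff_one_surjective : Function.Surjective (diff 1) := by
  intro f
  induction f using Polynomial.induction_on' with
  | add p q hp hq =>
    obtain ⟨P, rfl⟩ := hp
    obtain ⟨Q, rfl⟩ := hq
    exact ⟨P + Q, map_add _ _ _⟩
  | monomial n a =>
    set b : ℂ[X] := (Polynomial.bernoulli (n + 1)).map (algebraMap ℚ ℂ) with hb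
    have h : diff 1 b = -((n : ℂ) + 1) • Polynomial.monomial n 1 := by
      have h1 := congrArg (Polynomial.map (algebraMap ℚ ℂ)) (Polynomial.bernoulli_comp_one_add_X (n + 1))
      rw [Polynomial.map_comp] at h1
      have h2 : taylor 1 b = b + ((n : ℂ) + 1) • Polynomial.monomial n 1 := by
        rw [Polynomial.taylor_apply, hb]
        simp only [Polynomial.map_add, Polynomial.map_one, Polynomial.map_X] at h1
        rw [Polynomial.C_1, add_comm Polynomial.X, h1, ← Polynomial.X_pow_eq_monomial]
        simp [Polynomial.smul_eq_C_mul]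
      rw [diff_apply, h2]
      simp only [neg_smul]
      abel
    have hn : (n : ℂ) + 1 ≠ 0 := Nat.cast_add_one_ne_zero n
    refine ⟨(-(a / ((n : ℂ) + 1))) • b, ?_⟩
    rw [map_smul, h, smul_smul, Polynomial.smul_monomial]
    congr 1
    field_simp
    simp

theorem diff_neg_one_surjective : Function.Surjective (diff (-1)) := by
  intro f
  obtain ⟨g, hg⟩ := diff_one_surjective (taylor 1 f)
  refine ⟨-g, ?_⟩
  have h := congrArg (taylor (-1 : ℂ)) hg
  rw [diff_apply, map_sub, Polynomial.taylor_taylor, Polynomial.taylor_taylor] at h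
  simp only [neg_add_cancel, Polynomial.taylor_zero] at h
  rw [diff_apply, map_neg, ← h]
  abel

/-- A two-cocycle on `𝒟` with suitably normalized values vanishes. -/
theorem cocycle_eq_zero {M : Type*} [AddCommGroup M] [Module ℂ M]
    (B : diffOp →ₗ[ℂ] diffOp →ₗ[ℂ] M) (hskew : ∀ x y, B x y = -B y x)
    (hjac : ∀ x y z, B x ⁅y, z⁆ = B ⁅x, y⁆ z + B y ⁅x, z⁆)
    (hθ : ∀ r f, r ≠ 0 → B (hom 0 Polynomial.X) (hom r f) = 0)
    (ht : ∀ f, B (hom 1 1) (hom (-1) f) = 0) (x y : diffOp) : B x y = 0 := by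
  have hθl : ∀ r f, ⁅hom 0 Polynomial.X, hom r f⁆ = (r : ℂ) • hom r f := by
    intro r f
    rw [lie_hom, ← map_smul, zero_add]
    congr 1
    simp [add_mul, Polynomial.smul_eq_C_mul]
  have hdeg : ∀ r s f g, r + s ≠ 0 → B (hom r f) (hom s g) = 0 := by
    intro r s f g hrs
    have h := hjac (hom 0 Polynomial.X) (hom r f) (hom s g)
    rw [lie_hom, hθ _ _ hrs, hθl, hθl, map_smul, map_smul, LinearMap.smul_apply, ← add_smul] at h
    exact (smul_eq_zero.1 h.symm).resolve_left (by exact_mod_cast hrs)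
  have htl : ∀ r f, ⁅hom 1 1, hom r f⁆ = hom (1 + r) (diff 1 f) := by
    intro r f
    rw [lie_hom]; simp [diff_apply]
  have htl' : ∀ r f, ⁅hom (-1) 1, hom r f⁆ = hom (-1 + r) (diff (-1) f) := by
    intro r f
    rw [lie_hom]; simp [diff_apply]
  have step : ∀ r s f g, r + s = -1 →
      B (hom (1 + r) (diff 1 f)) (hom s g) = -B (hom r f) (hom (1 + s) (diff 1 g)) := by
    intro r s f g hrs
    have h := hjac (hom 1 1) (hom r f) (hom s g)
    rw [lie_hom, hrs, ht, htl, htl] at h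
    exact eq_neg_of_add_eq_zero_left h.symm
  have ht' : ∀ f, B (hom (-1) 1) (hom 1 f) = 0 := by
    intro f
    obtain ⟨g, rfl⟩ := diff_one_surjective f
    have h := step 0 (-1) g 1 (by norm_num)
    rw [add_zero] at h
    rw [hskew, h]
    simp [diff_apply]
  have step' : ∀ f g, B (hom (-1) (diff (-1) f)) (hom 1 g) = -B (hom 0 f) (hom 0 (diff (-1) g)) := by
    intro f g
    have h := hjac (hom (-1) 1) (hom 0 f) (hom 1 g)
    rw [lie_hom, zero_add, ht', htl', htl'] at h
    exact eq_neg_of_add_eq_zero_left h.symm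
  have hself : ∀ f g, B (hom 0 f) (hom 0 (diff 1 (diff (-1) g)))
      = B (hom 0 (diff (-1) (diff 1 f))) (hom 0 g) := by
    intro f g
    have h1 := step 0 (-1) f (diff (-1) g) (by norm_num)
    have h2 := step' g (diff 1 f)
    rw [add_zero] at h1
    rw [hskew, h1, neg_neg] at h2
    rw [hskew (hom 0 (diff (-1) (diff 1 f)))]
    exact h2
  have hzero : ∀ (n : ℕ) (f g : ℂ[X]), f.degree < n → B (hom 0 f) (hom 0 g) = 0 := by
    intro n
    induction n with
    | zero =>
      intro f g hf
      have : f = 0 := Polynomial.degree_eq_bot.1 (by simpa using hf)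
      simp [this]
    | succ n ih =>
      intro f g hf
      by_cases hf0 : f = 0
      · simp [hf0]
      obtain ⟨g, rfl⟩ := diff_one_surjective g
      obtain ⟨g, rfl⟩ := diff_neg_one_surjective g
      rw [hself]
      refine ih _ _ ((degree_diff_le _ _).trans_lt ?_)
      rw [Polynomial.degree_eq_natDegree hf0] at hf
      have h1 := degree_diff_lt 1 hf0
      rw [Polynomial.degree_eq_natDegree hf0] at h1
      refine h1.trans_le ?_
      have : f.natDegree < n + 1 := by exact_mod_cast hf
      exact_mod_cast Nat.lt_succ_iff.1 this
  have hpos : ∀ (r : ℕ) (f g : ℂ[X]), B (hom r f) (hom (-r) g) = 0 := by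
    intro r
    induction r with
    | zero =>
      intro f g
      simpa using hzero (f.natDegree + 1) f g
        (Polynomial.degree_le_natDegree.trans_lt (by exact_mod_cast Nat.lt_succ_self _))
    | succ r ih =>
      intro f g
      obtain ⟨f, rfl⟩ := diff_one_surjective f
      have h := step r (-((r + 1 : ℕ) : ℤ)) f g (by push_cast; ring)
      rw [show (1 : ℤ) + r = ((r + 1 : ℕ) : ℤ) by push_cast; ring,
        show (1 : ℤ) + -((r + 1 : ℕ) : ℤ) = -(r : ℤ) by push_cast; ring, ih, neg_zero] at h
      exact h
  induction x using diffOp_induction with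
  | h0 => simp
  | hadd A A' hA hA' => rw [map_add, LinearMap.add_apply, hA, hA', add_zero]
  | hhom r f =>
    induction y using diffOp_induction with
    | h0 => simp
    | hadd A A' hA hA' => rw [map_add, hA, hA', add_zero]
    | hhom s g =>
      by_cases hrs : r + s = 0
      · obtain rfl : s = -r := by lia
        obtain ⟨n, rfl | rfl⟩ := r.eq_nat_or_neg
        · exact hpos n f g
        · rw [hskew, neg_neg, hpos, neg_zero]
      · exact hdeg r s f g hrs

theorem psiFun_hom_nat (r : ℕ) (s : ℤ) (f g : ℂ[X]) :
    psiFun (hom r f) (hom s g) = if (r : ℤ) + s = 0 then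
      ∑ j ∈ Finset.Ico (-(r : ℤ)) 0, f.eval (j : ℂ) * g.eval ((j : ℂ) + r) else 0 :=
  psiFun_homog r s f g

theorem psiFun_hom_zero (s : ℤ) (f g : ℂ[X]) : psiFun (hom 0 f) (hom s g) = 0 := by
  simpa using psiFun_hom_nat 0 s f g

theorem psiFun_hom_one (g : ℂ[X]) : psiFun (hom 1 1) (hom (-1) g) = g.eval 0 := by
  have h : Finset.Ico (-1 : ℤ) 0 = {-1} := by decide
  simpa [h] using psiFun_hom_nat 1 (-1) 1 g

end DiffCircle

namespace DHat

open DiffCircle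

theorem isCentralExtension_proj : IsCentralExtension proj := by
  refine ⟨fun A => ⟨lift A, rfl⟩, ?_⟩
  rintro ⟨⟨A, a⟩⟩ hA ⟨⟨B, b⟩⟩
  obtain rfl : A = 0 := hA
  refine (lie_mk 0 B a b).trans ?_
  rw [zero_lie]
  have : psiFun (0 : diffOp) B = 0 := psiBilin.map_zero₂ B
  rw [this]
  rfl

set_option maxHeartbeats 2000000 in
/-- `𝒟̂` is the universal central extension of the Lie algebra of differential operators on the
circle. -/
theorem isUniversalCentralExtension.{w} : IsUniversalCentralExtension.{0, 0, w} proj := by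
  refine ⟨isCentralExtension_proj, fun E _ _ q hq => ?_⟩
  obtain ⟨hqs, hqc⟩ := hq
  have hlie : ∀ u v u' v' : E, q u = q u' → q v = q v' → ⁅u, v⁆ = ⁅u', v'⁆ := by
    intro u v u' v' hu hv
    have h1 : ⁅u - u', v⁆ = 0 := hqc _ (by rw [map_sub, hu, sub_self]) _
    have h2 : ⁅v - v', u'⁆ = 0 := hqc _ (by rw [map_sub, hv, sub_self]) _
    rw [sub_lie, sub_eq_zero] at h1 h2
    rw [h1, ← lie_skew, h2, lie_skew]
  obtain ⟨σ, hσ'⟩ := (q : E →ₗ[ℂ] diffOp).exists_rightInverse_of_surjective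
    (LinearMap.range_eq_top.2 hqs)
  have hσ : ∀ x, q (σ x) = x := fun x => LinearMap.congr_fun hσ' x
  obtain ⟨R, hR'⟩ := (diff 1).exists_rightInverse_of_surjective
    (LinearMap.range_eq_top.2 diff_one_surjective)
  have hR : ∀ x, diff 1 (R x) = x := fun x => LinearMap.congr_fun hR' x
  -- the bilinear map given by the bracket of lifts
  let b : diffOp →ₗ[ℂ] diffOp →ₗ[ℂ] E := LinearMap.mk₂ ℂ (fun x y => ⁅σ x, σ y⁆)
    (fun x x' y => by rw [map_add, add_lie]) (fun c x y => by rw [map_smul, smul_lie])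
    (fun x y y' => by rw [map_add, lie_add]) (fun c x y => by rw [map_smul, lie_smul])
  have hb : ∀ x y, b x y = ⁅σ x, σ y⁆ := fun x y => rfl
  have hqb : ∀ x y, q (b x y) = ⁅x, y⁆ := fun x y => by rw [hb, LieHom.map_lie, hσ, hσ]
  set c : E := b (hom 1 1) (hom (-1) 1) with hc
  have hqc' : q c = 0 := by
    rw [hc, hqb, lie_hom]; simp
  -- the section
  let sr : ℤ → ℂ[X] →ₗ[ℂ] E := fun r =>
    if r = 0 then b (hom 1 1) ∘ₗ hom (-1) ∘ₗ R -
        (LinearMap.toSpanSingleton ℂ E c) ∘ₗ (Polynomial.leval (0 : ℂ)) ∘ₗ R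
      else ((r : ℂ)⁻¹) • (b (hom 0 Polynomial.X) ∘ₗ hom r)
  let s : diffOp →ₗ[ℂ] E := Finsupp.lsum ℂ sr ∘ₗ components.symm.toLinearMap
  have hs : ∀ r f, s (hom r f) = sr r f := by
    intro r f
    have : components.symm (hom r f) = Finsupp.single r f := by
      rw [← components_single, LinearEquiv.symm_apply_apply]
    simp [s, this]
  have hs0 : ∀ f, s (hom 0 f) = b (hom 1 1) (hom (-1) (R f)) - (R f).eval 0 • c := by
    intro f
    rw [hs]; simp [sr]
  have hsr : ∀ r f, r ≠ 0 → s (hom r f) = (r : ℂ)⁻¹ • b (hom 0 Polynomial.X) (hom r f) := by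
    intro r f hr
    rw [hs]; simp [sr, hr]
  have hθl : ∀ r f, ⁅hom 0 Polynomial.X, hom r f⁆ = (r : ℂ) • hom r f := by
    intro r f
    rw [lie_hom, ← map_smul, zero_add]
    congr 1
    simp [add_mul, Polynomial.smul_eq_C_mul]
  have htl : ∀ r f, ⁅hom 1 1, hom r f⁆ = hom (1 + r) (diff 1 f) := by
    intro r f
    rw [lie_hom]; simp [diff_apply]
  have hqs : ∀ x, q (s x) = x := by
    intro x
    induction x using diffOp_induction with
    | h0 => simp
    | hadd A B hA hB => rw [map_add, map_add, hA, hB]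
    | hhom r f =>
      by_cases hr : r = 0
      · subst hr
        rw [hs0, map_sub, map_smul, hqb, hqc', smul_zero, sub_zero, htl, hR]
        simp
      · rw [hsr r f hr, map_smul, hqb, hθl, smul_smul, inv_mul_cancel₀ (by exact_mod_cast hr),
          one_smul]
  -- the defect of the section
  let B : diffOp →ₗ[ℂ] diffOp →ₗ[ℂ] E := LinearMap.mk₂ ℂ
    (fun x y => b x y - s ⁅x, y⁆ - psiBilin x y • c)
    (fun x x' y => by simp only [map_add, add_lie, LinearMap.add_apply, add_smul]; abel)
    (fun a x y => by
      simp only [map_smul, smul_lie, LinearMap.smul_apply, smul_sub, smul_eq_mul, mul_smul])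
    (fun x y y' => by simp only [map_add, lie_add, add_smul]; abel)
    (fun a x y => by simp only [map_smul, lie_smul, smul_sub, smul_eq_mul, mul_smul])
  have hB : ∀ x y, B x y = b x y - s ⁅x, y⁆ - psiBilin x y • c := fun x y => rfl
  have hbs : ∀ x y z, b x ⁅y, z⁆ = ⁅σ x, ⁅σ y, σ z⁆⁆ := fun x y z =>
    hlie _ _ _ _ rfl (by rw [hσ, LieHom.map_lie, hσ, hσ])
  have hbs' : ∀ x y z, b ⁅x, y⁆ z = ⁅⁅σ x, σ y⁆, σ z⁆ := fun x y z =>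
    hlie _ _ _ _ (by rw [hσ, LieHom.map_lie, hσ, hσ]) rfl
  have hB0 : ∀ x y, B x y = 0 := by
    refine cocycle_eq_zero B ?_ ?_ ?_ ?_
    · intro x y
      rw [hB, hB, hb, hb, ← lie_skew (σ x), ← lie_skew x y, psiBilin_swap x y, map_neg, neg_smul]
      abel
    · intro x y z
      rw [hB, hB, hB, hbs, hbs, hbs', psiBilin_jacobi, leibniz_lie (σ x), leibniz_lie x, map_add,
        add_smul]
      abel
    · intro r f hr
      have hp : psiBilin (hom 0 Polynomial.X) (hom r f) = 0 := psiFun_hom_zero _ _ _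
      rw [hB, hp, hθl, map_smul, hsr r f hr, smul_smul, mul_inv_cancel₀ (by exact_mod_cast hr)]
      simp
    · intro f
      have hp : psiBilin (hom 1 1) (hom (-1) f) = f.eval 0 := psiFun_hom_one f
      have hk : ∀ g : ℂ[X], diff 1 g = 0 → b (hom 1 1) (hom (-1) g) = g.eval 0 • c := by
        intro g hg
        have : g = Polynomial.C (g.eval 0) := by
          by_contra hne
          have hg0 : g - Polynomial.C (g.eval 0) ≠ 0 := sub_ne_zero.2 hne
          refine hg0 (Polynomial.eq_zero_of_infinite_isRoot _ ?_)
          refine Set.Infinite.mono ?_ (Set.infinite_range_of_injective (Nat.cast_injective (R := ℂ)))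
          rintro _ ⟨n, rfl⟩
          change Polynomial.eval _ _ = 0
          rw [Polynomial.eval_sub, Polynomial.eval_C, sub_eq_zero]
          induction n with
          | zero => simp
          | succ n ih =>
            rw [diff_apply, sub_eq_zero] at hg
            rw [← ih, Nat.cast_succ, ← Polynomial.taylor_eval, ← hg]
        have h2 : hom (-1) g = (g.eval 0) • hom (-1) 1 := by
          rw [← map_smul]
          conv_lhs => rw [this]
          simp [Polynomial.smul_eq_C_mul]
        rw [h2, map_smul]
      have h3 := hk (f - R (diff 1 f)) (by rw [map_sub, hR, sub_self])
      rw [map_sub, map_sub, Polynomial.eval_sub, sub_smul] at h3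
      rw [hB, hp, htl]
      change b (hom 1 1) (hom (-1) f) - s (hom 0 (diff 1 f)) - _ = 0
      rw [hs0]
      rw [← sub_eq_zero] at h3
      rw [← h3]
      abel
  let F : DHat →ₗ⁅ℂ⁆ E :=
    { toFun := fun x => s x.carrier.1 + (show ℂ from x.carrier.2) • c
      map_add' := fun x y => by
        change s (x.carrier.1 + y.carrier.1) +
          ((show ℂ from x.carrier.2) + (show ℂ from y.carrier.2)) • c = _
        rw [map_add, add_smul]; abel
      map_smul' := fun a x => by
        change s (a • x.carrier.1) + (a * (show ℂ from x.carrier.2)) • c = _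
        rw [map_smul, mul_smul, RingHom.id_apply, smul_add]
      map_lie' := by
        rintro ⟨⟨x, a⟩⟩ ⟨⟨y, a'⟩⟩
        change s ⁅x, y⁆ + (psiBilin x y + 0 - 0) • c
          = ⁅s x + (show ℂ from a) • c, s y + (show ℂ from a') • c⁆
        rw [add_zero, sub_zero]
        have h1 := hB0 x y
        rw [hB, sub_sub, sub_eq_zero] at h1
        rw [← h1]
        refine hlie _ _ _ _ ?_ ?_ <;> rw [map_add, map_smul, hqc', hqs, hσ, smul_zero, add_zero] }
  refine ⟨F, ?_, ?_⟩
  · rintro ⟨⟨x, a⟩⟩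
    change q (s x + (show ℂ from a) • c) = x
    rw [map_add, map_smul, hqc', hqs, smul_zero, add_zero]
  · intro G hG
    have hF : ∀ x, q (F x) = proj x := by
      rintro ⟨⟨x, a⟩⟩
      change q (s x + (show ℂ from a) • c) = x
      rw [map_add, map_smul, hqc', hqs, smul_zero, add_zero]
    have hbr : ∀ u v : DHat, G ⁅u, v⁆ = F ⁅u, v⁆ := by
      intro u v
      rw [LieHom.map_lie, LieHom.map_lie]
      exact hlie _ _ _ _ ((hG u).trans (hF u).symm) ((hG v).trans (hF v).symm)
    have hcen : G central = F central := by
      have : (central : DHat) = ⁅lift (hom 1 1), lift (hom (-1) 1)⁆ := by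
        rw [lie_lift, psiFun_hom_one, lie_hom]; simp
      rw [this, hbr]
    have hlift : ∀ A, G (lift A) = F (lift A) := by
      intro A
      induction A using diffOp_induction with
      | h0 => simp
      | hadd A B hA hB => rw [map_add, map_add, map_add, hA, hB]
      | hhom r f =>
        by_cases hr : r = 0
        · subst hr
          have h1 := lie_lift (hom 1 1) (hom (-1) (R f))
          rw [psiFun_hom_one, htl, hR] at h1
          have h2 : lift (hom 0 f) = ⁅lift (hom 1 1), lift (hom (-1) (R f))⁆
              - (R f).eval 0 • central := by
            rw [h1]; simp
          rw [h2, map_sub, map_sub, map_smul, map_smul, hbr, hcen]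
        · have h1 := lie_lift (hom 0 Polynomial.X) (hom r f)
          rw [psiFun_hom_zero, hθl, zero_smul, add_zero, map_smul] at h1
          have h2 : lift (hom r f) = (r : ℂ)⁻¹ • ⁅lift (hom 0 Polynomial.X), lift (hom r f)⁆ := by
            rw [h1, smul_smul, inv_mul_cancel₀ (by exact_mod_cast hr), one_smul]
          rw [h2, map_smul, map_smul, hbr]
    refine LieHom.ext fun x => ?_
    obtain ⟨⟨A, a⟩⟩ := x
    have hmk : ∀ d : ℂ, G (lift A + d • central) = F (lift A + d • central) := fun d => by
      rw [map_add, map_add, map_smul, map_smul, hlift, hcen]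
    exact (congrArg G (mk_eq A a)).trans ((hmk a).trans (congrArg F (mk_eq A a)).symm)

end DHat

/-! ### Irreducible submodules -/

/-- The subspace `W` is an irreducible submodule for the action `ρ`: it is stable, nonzero, and has
no stable subspaces except `0` and `W`. -/
def IsIrreducibleOn {L V : Type*} [LieRing L] [LieAlgebra ℂ L] [AddCommGroup V] [Module ℂ V]
    (ρ : L →ₗ⁅ℂ⁆ Module.End ℂ V) (W : Submodule ℂ V) : Prop :=
  (∀ x, ∀ v ∈ W, ρ x v ∈ W) ∧ W ≠ ⊥ ∧
    ∀ U : Submodule ℂ V, U ≤ W → (∀ x, ∀ v ∈ U, ρ x v ∈ U) → U = ⊥ ∨ U = W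

end

noncomputable section

open Fock FormalField HVertexOperator

/-! ### Paired fermions -/

open DiffCircle

/-! One neutral fermion is a charged pair in disguise. The odd coefficients of `phiD` give modes `q
i` = φ_{2i+1/2}, the even ones give `m i` = φ_{-2i-1/2}, and {q_i, m_j} = δ_ij while the q's, and
likewise the m's, anticommute. The modes q_i = ψ⁺_i, m_i = ψ⁻_{-i-1} satisfy the same relations with
the same vacuum conditions. In these modes both families of currents become (-1)^k ∑_j
j(j-1)⋯(j-k+1) :q_{j+n} m_j:. Since J^k_n = (-1)^k t^n θ(θ-1)⋯(θ-k+1) with θ = t∂_t, both are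
instances of the single assignment t^r f(θ) ↦ ∑_j f(j) :q_{j+r} m_j:. Everything is therefore proved
for an abstract `PairedModes` and specialized twice.

Representation (`current_bracket`): a current acts on the modes by commutator as a differential
operator acts on powers of t. Hence the difference between the commutator of two currents and the
current of the bracket commutes with all modes. By a Schur argument it is a scalar, and its vacuum
expectation value is Ψ. Uniqueness holds because the falling factorials span the polynomials and C =
[J^0_1, J^0_{-1}].

Irreducibility: Lagrange interpolation shows that a stable subspace is stable under each single q_i
m_j (`normalPair_mem`). The number operators among these products isolate a monomial
(`exists_mono_mem`), and the other products join any two monomials of equal degree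
(`mono_mem_of_dg_eq`).

Isomorphism: a bijection between the two index sets, corrected by the sign of the reordering,
intertwines all modes and so the two actions. -/

/-- Charged free fermions with modes `q i` and `m i`, `i ∈ ℤ`, such that `q i` (`i ≥ 0`) and
`m i` (`i < 0`) kill the vacuum, on an irreducible module: only scalars commute with all modes. The
functional `ev` is the coefficient of the vacuum. -/
structure PairedModes (V : Type) [AddCommGroup V] [Module ℂ V] where
  /-- The modes of the first family. -/
  q : ℤ → Module.End ℂ V
  /-- The modes of the second family. -/
  m : ℤ → Module.End ℂ V
  /-- The vacuum vector. -/
  vac : V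
  /-- The vacuum coefficient. -/
  ev : V →ₗ[ℂ] ℂ
  q_m : ∀ i j, q i * m j + m j * q i = if i = j then 1 else 0
  q_q : ∀ i j, q i * q j + q j * q i = 0
  m_m : ∀ i j, m i * m j + m j * m i = 0
  finite_q : ∀ v, {i | 0 ≤ i ∧ q i v ≠ 0}.Finite
  finite_m : ∀ v, {i | i < 0 ∧ m i v ≠ 0}.Finite
  q_vac : ∀ i, 0 ≤ i → q i vac = 0
  m_vac : ∀ i, i < 0 → m i vac = 0
  ev_vac : ev vac = 1
  ev_q : ∀ i v, i < 0 → ev (q i v) = 0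
  eq_smul_one : ∀ D : Module.End ℂ V, (∀ k, D * q k = q k * D) → (∀ k, D * m k = m k * D) →
    D = ev (D vac) • 1

namespace PairedModes

variable {V : Type} [AddCommGroup V] [Module ℂ V]

/-- The normal ordered product `:q_i m_j:`. -/
def normalPair (F : PairedModes V) (i j : ℤ) : Module.End ℂ V :=
  if i < 0 then F.q i * F.m j else -(F.m j * F.q i)

/-- By the anticommutation relation, normal ordering alters the plain product only by a scalar.
Commutators may therefore be computed with plain products. -/
theorem normalPair_eq (F : PairedModes V) (i j : ℤ) :
    F.normalPair i j = F.q i * F.m j - if i = j ∧ 0 ≤ i then 1 else 0 := by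
  have h := F.q_m i j
  unfold normalPair
  by_cases hi : i < 0
  · rw [if_pos hi, if_neg (by lia), sub_zero]
  · rw [if_neg hi, eq_sub_of_add_eq h]
    simp [not_lt.1 hi]

/-- The scalar drops out, and [ab, c] = a{b, c} - {a, c}b. So :q_i m_j: acts on the span of the q's
as the matrix unit E_ij, and below on the m's as in the dual representation. -/
theorem normalPair_qMode (F : PairedModes V) (i j k : ℤ) :
    F.normalPair i j * F.q k - F.q k * F.normalPair i j
      = if j = k then F.q i else 0 := by
  have h1 := F.q_m k j
  have h2 := F.q_q i k
  rw [normalPair_eq]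
  have e : (F.q i * F.m j - if i = j ∧ 0 ≤ i then 1 else 0) * F.q k
      - F.q k * (F.q i * F.m j - if i = j ∧ 0 ≤ i then 1 else 0)
      = F.q i * (F.q k * F.m j + F.m j * F.q k)
        - (F.q i * F.q k + F.q k * F.q i) * F.m j := by
    split_ifs <;> noncomm_ring
  rw [e, h1, h2]
  by_cases h : j = k
  · simp [h]
  · simp [h, Ne.symm h]

theorem normalPair_mMode (F : PairedModes V) (i j k : ℤ) :
    F.normalPair i j * F.m k - F.m k * F.normalPair i j
      = if i = k then -F.m j else 0 := by
  have h1 := F.q_m i k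
  have h2 := F.m_m j k
  rw [normalPair_eq]
  have e : (F.q i * F.m j - if i = j ∧ 0 ≤ i then 1 else 0) * F.m k
      - F.m k * (F.q i * F.m j - if i = j ∧ 0 ≤ i then 1 else 0)
      = F.q i * (F.m j * F.m k + F.m k * F.m j)
        - (F.q i * F.m k + F.m k * F.q i) * F.m j := by
    split_ifs <;> noncomm_ring
  rw [e, h1, h2]
  by_cases h : i = k <;> simp [h]

/-- Outside the window 0 ≤ j < -r the factor that acts first is one that kills the vacuum, and for
all but finitely many j such a mode also kills v. -/
theorem finite_normalPair (F : PairedModes V) (r : ℤ) (v : V) :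
    (Function.support fun j : ℤ => F.normalPair (j + r) j v).Finite := by
  refine (((F.finite_m v).union ((F.finite_q v).preimage (add_left_injective r).injOn)).union
    (Set.finite_Ico 0 (-r))).subset fun j hj => ?_
  by_contra hc
  simp only [Set.mem_union, Set.mem_preimage, Set.mem_ofPred_eq, Set.mem_Ico, not_or, not_and,
    not_not] at hc
  refine hj ?_
  change F.normalPair (j + r) j v = 0
  unfold normalPair
  split_ifs with hi
  · rw [Module.End.mul_apply, hc.1.1 (by lia), map_zero]
  · rw [LinearMap.neg_apply, Module.End.mul_apply, hc.1.2 (by lia), map_zero, neg_zero]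

theorem finite_smul_normalPair (F : PairedModes V) (r : ℤ) (g : ℤ → ℂ) (v : V) :
    (Function.support fun j : ℤ => g j • F.normalPair (j + r) j v).Finite :=
  (finite_normalPair F r v).subset (Function.support_smul_subset_right _ _)

/-- The operator `∑_j f(j) :Q_{j+r} M_j:`. -/
def current (F : PairedModes V) (r : ℤ) : ℂ[X] →ₗ[ℂ] Module.End ℂ V where
  toFun f :=
    { toFun := fun v => ∑ᶠ j : ℤ, f.eval (j : ℂ) • F.normalPair (j + r) j v
      map_add' := fun u v => by
        simp only [map_add, smul_add]
        exact finsum_add_distrib (finite_smul_normalPair F r _ u) (finite_smul_normalPair F r _ v)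
      map_smul' := fun c v => by
        simp only [map_smul, RingHom.id_apply, smul_comm _ c]
        exact (smul_finsum' c (finite_smul_normalPair F r _ v)).symm }
  map_add' f g := LinearMap.ext fun v => by
    simp only [LinearMap.coe_mk, AddHom.coe_mk, LinearMap.add_apply, Polynomial.eval_add, add_smul]
    exact finsum_add_distrib (finite_smul_normalPair F r _ v) (finite_smul_normalPair F r _ v)
  map_smul' c f := LinearMap.ext fun v => by
    simp only [LinearMap.coe_mk, AddHom.coe_mk, LinearMap.smul_apply, Polynomial.eval_smul,
      smul_assoc, RingHom.id_apply]
    exact (smul_finsum' c (finite_smul_normalPair F r _ v)).symm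

theorem current_apply (F : PairedModes V) (r : ℤ) (f : ℂ[X]) (v : V) :
    F.current r f v = ∑ᶠ j : ℤ, f.eval (j : ℂ) • F.normalPair (j + r) j v := rfl

/-- Only the summand j = k fails to commute with X, so the infinite sum contributes a single term.
-/
theorem current_commutator (F : PairedModes V) (r k : ℤ) (f : ℂ[X]) {X Y : Module.End ℂ V}
    (h : ∀ j, F.normalPair (j + r) j * X - X * F.normalPair (j + r) j = if j = k then Y else 0) :
    F.current r f * X = X * F.current r f + f.eval (k : ℂ) • Y := by
  refine LinearMap.ext fun v => ?_
  simp only [LinearMap.add_apply, LinearMap.smul_apply, Module.End.mul_apply, current_apply]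
  rw [map_finsum X (finite_smul_normalPair F r _ v),
    ← sub_eq_iff_eq_add', ← finsum_sub_distrib (finite_smul_normalPair F r _ _)
    ((finite_smul_normalPair F r _ v).subset fun j hj h0 => hj (by
      simp only at h0 ⊢; rw [h0, map_zero]))]
  have h' : ∀ j : ℤ, f.eval (j : ℂ) • F.normalPair (j + r) j (X v)
      - X (f.eval (j : ℂ) • F.normalPair (j + r) j v)
      = if j = k then f.eval (j : ℂ) • Y v else 0 := by
    intro j
    have := LinearMap.congr_fun (h j) v
    rw [LinearMap.sub_apply, Module.End.mul_apply, Module.End.mul_apply] at this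
    rw [map_smul, ← smul_sub, this]
    split_ifs <;> simp
  rw [finsum_congr h', finsum_eq_single _ k (fun j hj => if_neg hj), if_pos rfl]

theorem current_qMode (F : PairedModes V) (r k : ℤ) (f : ℂ[X]) :
    F.current r f * F.q k = F.q k * F.current r f + f.eval (k : ℂ) • F.q (k + r) :=
  current_commutator F r k f fun j => by
    rw [normalPair_qMode]
    exact if_ctx_congr Iff.rfl (fun h => by rw [h]) fun _ => rfl

theorem current_mMode (F : PairedModes V) (r k : ℤ) (f : ℂ[X]) :
    F.current r f * F.m k
      = F.m k * F.current r f + f.eval ((k : ℂ) - r) • -F.m (k - r) := by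
  -- The summand that meets `m k` has j + r = k, whence the coefficient f(k - r).
  rw [current_commutator F r (k - r) f (Y := -F.m (k - r)), Int.cast_sub]
  intro j
  rw [normalPair_mMode]
  exact if_ctx_congr (by lia) (fun h => by rw [h]) fun _ => rfl

theorem current_vac (F : PairedModes V) (r : ℤ) (f : ℂ[X]) :
    F.current r f F.vac = ∑ j ∈ Finset.Ico 0 (-r),
      f.eval (j : ℂ) • F.q (j + r) (F.m j F.vac) := by
  have hz : ∀ j : ℤ, j ∉ Finset.Ico 0 (-r) → F.normalPair (j + r) j F.vac = 0 := by
    intro j hj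
    rw [Finset.mem_Ico] at hj
    unfold normalPair
    split_ifs with hi
    · rw [Module.End.mul_apply, F.m_vac _ (by lia), map_zero]
    · rw [LinearMap.neg_apply, Module.End.mul_apply, F.q_vac _ (by lia), map_zero, neg_zero]
  rw [current_apply, finsum_eq_sum_of_support_subset (s := Finset.Ico 0 (-r))]
  · refine Finset.sum_congr rfl fun j hj => ?_
    rw [Finset.mem_Ico] at hj
    rw [normalPair, if_pos (by lia), Module.End.mul_apply]
  · intro j hj
    by_contra hc
    exact hj (by simp only; rw [hz j hc, smul_zero])

/-- The inner current produces vectors q_{j+t} m_j |0⟩ with j + t < 0. Moving the outer current past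
the creation mode q_{j+t} leaves, under `ev`, only the commutator term f(j+t) q_{j+t+r} m_j |0⟩,
whose vacuum coefficient is δ_{r+t,0} f(j+t). -/
theorem current_current_vac (F : PairedModes V) (r t : ℤ) (f g : ℂ[X]) :
    F.ev (F.current r f (F.current t g F.vac)) = if r + t = 0 then
      ∑ j ∈ Finset.Ico 0 (-t), g.eval (j : ℂ) * f.eval ((j : ℂ) + t) else 0 := by
  have h : ∀ j ∈ Finset.Ico 0 (-t), F.ev (F.current r f (F.q (j + t) (F.m j F.vac)))
      = if r + t = 0 then f.eval ((j : ℂ) + t) else 0 := by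
    intro j hj
    rw [Finset.mem_Ico] at hj
    have h1 := LinearMap.congr_fun (current_qMode F r (j + t) f) (F.m j F.vac)
    rw [Module.End.mul_apply] at h1
    rw [h1, LinearMap.add_apply, Module.End.mul_apply, map_add]
    have h2 : ∀ w, F.ev (F.q (j + t) w) = 0 := fun w => F.ev_q _ w (by lia)
    rw [h2, zero_add, LinearMap.smul_apply, map_smul, Int.cast_add]
    have h3 : F.ev (F.q (j + t + r) (F.m j F.vac)) = if r + t = 0 then 1 else 0 := by
      -- For a negative index `ev` vanishes on the image of q, and r + t = 0 is impossible because 0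
      -- ≤ j. Otherwise q kills the vacuum and the anticommutator with `m j` gives the value.
      by_cases hk : j + t + r < 0
      · rw [F.ev_q _ _ hk, if_neg (by lia)]
      · have h4 := LinearMap.congr_fun (F.q_m (j + t + r) j) F.vac
        rw [LinearMap.add_apply, Module.End.mul_apply, Module.End.mul_apply,
          F.q_vac _ (by lia), map_zero, add_zero] at h4
        rw [h4]
        by_cases hrt : r + t = 0
        · rw [if_pos (by lia), if_pos hrt]; simp [F.ev_vac]
        · rw [if_neg (by lia), if_neg hrt]; simp
    rw [h3]
    split_ifs <;> simp
  rw [current_vac, map_sum, map_sum]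
  simp only [map_smul, smul_eq_mul]
  rw [Finset.sum_congr rfl fun j hj => by rw [h j hj]]
  split_ifs <;> simp

end PairedModes

/-! ### The cocycle in the form of a vacuum expectation value -/

namespace DiffCircle

/-- This is the shape in which the vacuum expectation of a commutator of two currents appears,
without a sign condition on r. When r + t = 0, at most one of the two sums is nonempty. -/
theorem psiFun_hom (r t : ℤ) (f g : ℂ[X]) :
    psiFun (hom r f) (hom t g) = if r + t = 0 then
      ∑ j ∈ Finset.Ico 0 (-t), g.eval (j : ℂ) * f.eval ((j : ℂ) + t)
        - ∑ j ∈ Finset.Ico 0 (-r), f.eval (j : ℂ) * g.eval ((j : ℂ) + r) else 0 := by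
  have hnat : ∀ (r : ℕ) (t : ℤ) (f g : ℂ[X]), psiFun (hom r f) (hom t g) =
      if (r : ℤ) + t = 0 then ∑ j ∈ Finset.Ico 0 (-t), g.eval (j : ℂ) * f.eval ((j : ℂ) + t)
        else 0 := by
    intro r t f g
    rw [psiFun_hom_nat]
    refine if_ctx_congr Iff.rfl (fun h => ?_) fun _ => rfl
    obtain rfl : t = -(r : ℤ) := by lia
    refine Finset.sum_bij (fun j _ => j + (r : ℤ)) ?_ ?_ ?_ ?_
    · intro j hj; rw [Finset.mem_Ico] at hj ⊢; lia
    · intro a _ b _ h; simpa using h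
    · intro b hb
      rw [Finset.mem_Ico] at hb
      exact ⟨b - r, by rw [Finset.mem_Ico]; lia, by simp⟩
    · intro j _
      push_cast
      rw [mul_comm]
      congr 2
      ring
  rcases le_or_gt 0 r with hr | hr
  · obtain ⟨n, rfl⟩ := Int.eq_ofNat_of_zero_le hr
    rw [hnat, Finset.Ico_eq_empty (a := (0 : ℤ)) (b := -(n : ℤ)) (by lia)]
    simp
  rcases le_or_gt 0 t with ht | ht
  · obtain ⟨n, rfl⟩ := Int.eq_ofNat_of_zero_le ht
    rw [psiFun_swap, hnat, Finset.Ico_eq_empty (a := (0 : ℤ)) (b := -(n : ℤ)) (by lia),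
      add_comm r]
    split_ifs <;> simp
  -- Both operators lower the exponent of t, so neither has a matrix entry from a negative exponent
  -- to a nonnegative one, and each summand of the cocycle contains such an entry.
  · rw [if_neg (by lia), psiFun]
    refine finsum_eq_zero_of_forall_eq_zero fun p => ?_
    split_ifs with h
    · change mat (homog r f) _ _ * mat (homog t g) _ _ - mat (homog t g) _ _ * mat (homog r f) _ _
        = 0
      have h1 : mat (homog r f) p.1 p.2 = 0 := by rw [mat_homog, if_neg (by lia)]
      have h2 : mat (homog t g) p.1 p.2 = 0 := by rw [mat_homog, if_neg (by lia)]
      rw [h1, h2]; ring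
    · rfl

end DiffCircle

/-! ### Commutators of currents and the representation of central charge one -/

namespace PairedModes

variable {V : Type} [AddCommGroup V] [Module ℂ V]

/-- On modes the currents act as the differential operators do, without a cocycle, so the defect [A,
B] - C commutes with every mode and is a scalar by `eq_smul_one`. The scalar is its vacuum
expectation value, computed by `current_current_vac`. -/
theorem current_bracket (F : PairedModes V) (r t : ℤ) (f g : ℂ[X]) :
    F.current r f * F.current t g - F.current t g * F.current r f
      = F.current (r + t) (Polynomial.taylor (t : ℂ) f * g - f * Polynomial.taylor (r : ℂ) g)
        + psiFun (hom r f) (hom t g) • 1 := by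
  set h := Polynomial.taylor (t : ℂ) f * g - f * Polynomial.taylor (r : ℂ) g with hh
  have hev : ∀ x : ℂ, h.eval x = f.eval (x + t) * g.eval x - f.eval x * g.eval (x + r) := by
    intro x; simp [hh, Polynomial.taylor_eval]
  set A := F.current r f with hA
  set B := F.current t g with hB
  set C := F.current (r + t) h with hC
  -- The Jacobi identity with scalars kept track of: the mixed terms A₁B and B₁A cancel in the
  -- commutator, and only multiples of the doubly shifted mode Y remain.
  have key : ∀ {X A₁ B₁ Y : Module.End ℂ V} {a b a' b' c : ℂ},
      A * X = X * A + a • A₁ → B * X = X * B + b • B₁ →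
      A * B₁ = B₁ * A + a' • Y → B * A₁ = A₁ * B + b' • Y →
      C * X = X * C + c • Y → c = a' * b - b' * a →
      (A * B - B * A - C) * X = X * (A * B - B * A - C) := by
    intro X A₁ B₁ Y a b a' b' c h1 h2 h3 h4 h5 hc
    have e1 : A * B * X = X * A * B + a • A₁ * B + b • B₁ * A + (b * a') • Y := by
      rw [mul_assoc, h2, mul_add, ← mul_assoc, h1, mul_smul_comm, h3, add_mul, smul_add, smul_smul,
        smul_mul_assoc, smul_mul_assoc]
      abel
    have e2 : B * A * X = X * B * A + b • B₁ * A + a • A₁ * B + (a * b') • Y := by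
      rw [mul_assoc, h1, mul_add, ← mul_assoc, h2, mul_smul_comm, h4, add_mul, smul_add, smul_smul,
        smul_mul_assoc, smul_mul_assoc]
      abel
    rw [sub_mul, sub_mul, e1, e2, h5, hc, sub_smul, mul_sub, mul_sub, mul_comm b, mul_comm a,
      ← mul_assoc, ← mul_assoc]
    abel
  have hs := F.eq_smul_one (A * B - B * A - C) (fun k => by
      refine key (current_qMode F r k f) (current_qMode F t k g) (current_qMode F r (k + t) f)
        (b' := g.eval ((k + r : ℤ) : ℂ)) ?_ (c := h.eval (k : ℂ)) ?_ ?_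
      · rw [hB, current_qMode, add_right_comm]
      · rw [hC, current_qMode, ← add_assoc, add_right_comm]
      · rw [hev]; push_cast; ring) (fun k => by
      -- Each current shifts the m's with a sign -1. The two signs cancel in the iterated terms but
      -- one survives for C, which is why its coefficient is -h.
      refine key (Y := F.m (k - (r + t))) (current_mMode F r k f)
        (current_mMode F t k g) (a' := f.eval ((k : ℂ) - t - r)) (b' := g.eval ((k : ℂ) - r - t))
        (c := -h.eval ((k : ℂ) - r - t)) ?_ ?_ ?_ ?_
      · rw [hA, mul_neg, current_mMode, show k - t - r = k - (r + t) by lia]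
        push_cast
        rw [smul_neg, neg_add, neg_neg, neg_mul]
      · rw [hB, mul_neg, current_mMode, show k - r - t = k - (r + t) by lia]
        push_cast
        rw [smul_neg, neg_add, neg_neg, neg_mul]
      · rw [hC, current_mMode, smul_neg, neg_smul]
        push_cast
        rw [← sub_sub]
      · rw [hev]
        rw [show (k : ℂ) - r - t + t = k - r by ring, show (k : ℂ) - r - t + r = k - t by ring,
          show (k : ℂ) - t - r = k - r - t by ring]
        ring)
  have hv : F.ev ((A * B - B * A - C) F.vac) = psiFun (hom r f) (hom t g) := by
    -- A normal ordered current has no vacuum expectation: each surviving term begins with a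
    -- creation mode q of negative index.
    have h0 : F.ev (C F.vac) = 0 := by
      rw [hC, current_vac, map_sum]
      refine Finset.sum_eq_zero fun j hj => ?_
      rw [Finset.mem_Ico] at hj
      rw [map_smul, F.ev_q _ _ (by lia), smul_zero]
    rw [LinearMap.sub_apply, LinearMap.sub_apply, Module.End.mul_apply, Module.End.mul_apply,
      map_sub, map_sub, h0, current_current_vac, current_current_vac, psiFun_hom, add_comm t r]
    split_ifs <;> simp
  rw [← hv, ← hs]
  abel

/-- The linear map on `𝒟` sending `t ^ r f(t ∂_t)` to `∑_j f(j) :Q_{j+r} M_j:`. -/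
def currentMap (F : PairedModes V) : diffOp →ₗ[ℂ] Module.End ℂ V :=
  Finsupp.lsum ℂ (F.current) ∘ₗ components.symm.toLinearMap

theorem currentMap_hom (F : PairedModes V) (r : ℤ) (f : ℂ[X]) :
    F.currentMap (hom r f) = F.current r f := by
  have : components.symm (hom r f) = Finsupp.single r f := by
    rw [← components_single, LinearEquiv.symm_apply_apply]
  simp [currentMap, this]

theorem lie_add_smul_one (A B : Module.End ℂ V) (a b : ℂ) :
    ⁅A + a • 1, B + b • 1⁆ = ⁅A, B⁆ := by
  simp only [Ring.lie_def, add_mul, mul_add, smul_mul_assoc, mul_smul_comm, one_mul, mul_one,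
    smul_add]
  rw [smul_comm a b]
  abel

theorem currentMap_lie (F : PairedModes V) (A B : diffOp) :
    F.currentMap ⁅A, B⁆ + psiFun A B • 1 = ⁅F.currentMap A, F.currentMap B⁆ := by
  rw [← psiBilin_apply]
  induction A using diffOp_induction with
  | h0 => simp
  | hadd A A' hA hA' =>
    rw [add_lie, map_add, map_add, map_add, add_lie, ← hA, ← hA', LinearMap.add_apply, add_smul]
    abel
  | hhom r f =>
    induction B using diffOp_induction with
    | h0 => simp
    | hadd A A' hA hA' =>
      rw [lie_add, map_add, map_add, map_add, lie_add, ← hA, ← hA', add_smul]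
      abel
    | hhom t g =>
      rw [lie_hom, currentMap_hom, currentMap_hom, currentMap_hom]
      exact (current_bracket F r t f g).symm

/-- The representation of `𝒟̂` on a Fock space, of central charge one. -/
def rep (F : PairedModes V) : DHat →ₗ⁅ℂ⁆ Module.End ℂ V where
  toFun x := F.currentMap x.carrier.1 + (show ℂ from x.carrier.2) • 1
  map_add' x y := by
    change F.currentMap (x.carrier.1 + y.carrier.1) +
      ((show ℂ from x.carrier.2) + (show ℂ from y.carrier.2)) • 1 = _
    rw [map_add, add_smul]; abel
  map_smul' a x := by
    change F.currentMap (a • x.carrier.1) + (a * (show ℂ from x.carrier.2)) • 1 = _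
    rw [map_smul, mul_smul, RingHom.id_apply, smul_add]
  map_lie' := by
    rintro ⟨⟨x, a⟩⟩ ⟨⟨y, b⟩⟩
    change F.currentMap ⁅x, y⁆ + (psiFun x y + 0 - 0) • 1
      = ⁅F.currentMap x + (show ℂ from a) • 1, F.currentMap y + (show ℂ from b) • 1⁆
    rw [add_zero, sub_zero, currentMap_lie]
    exact (lie_add_smul_one _ _ _ _).symm

theorem rep_lift_hom (F : PairedModes V) (r : ℤ) (f : ℂ[X]) :
    F.rep (DHat.lift (hom r f)) = F.current r f := by
  change F.currentMap (hom r f) + (0 : ℂ) • 1 = _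
  rw [currentMap_hom, zero_smul, add_zero]

theorem rep_central (F : PairedModes V) : F.rep DHat.central = 1 := by
  change F.currentMap 0 + (1 : ℂ) • 1 = _
  rw [map_zero, zero_add, one_smul]

end PairedModes

namespace DHat

open DiffCircle

theorem induction_hom {P : DHat → Prop} (hadd : ∀ x y, P x → P y → P (x + y))
    (hhom : ∀ r f, P (lift (hom r f))) (hcen : ∀ c : ℂ, P (c • central)) (x : DHat) : P x := by
  obtain ⟨⟨A, c⟩⟩ := x
  refine (mk_eq A c).symm ▸ hadd _ _ ?_ (hcen c)
  induction A using diffOp_induction with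
  | h0 => simpa using hcen 0
  | hadd A B hA hB => rw [map_add]; exact hadd _ _ hA hB
  | hhom r f => exact hhom r f

end DHat

/-! ### Paired modes on a Fock space -/

namespace Fock

variable {ι : Type} [LinearOrder ι]

/-- The odd operators `Q_i`, `i ∈ ℤ`, on a Fock space whose modes are indexed by `s : ℤ ≃ ι`:
creation operators for `i < 0` and annihilation operators for `i ≥ 0`. -/
def qMode (s : ℤ ≃ ι) (i : ℤ) : Module.End ℂ (Fock ι) :=
  if i < 0 then create (s i) else annih (s i)

/-- The odd operators `M_i` dual to `Q_i`. -/
def mMode (s : ℤ ≃ ι) (i : ℤ) : Module.End ℂ (Fock ι) :=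
  if i < 0 then annih (s i) else create (s i)

theorem qMode_mMode (s : ℤ ≃ ι) (i j : ℤ) :
    qMode s i * mMode s j + mMode s j * qMode s i = if i = j then 1 else 0 := by
  unfold qMode mMode
  by_cases hi : i < 0 <;> by_cases hj : j < 0 <;> simp only [hi, hj, if_true, if_false]
  · rw [add_comm, annih_create]; simp [eq_comm]
  · rw [create_create, if_neg (by lia)]
  · rw [annih_annih, if_neg (by lia)]
  · rw [annih_create]; simp

theorem qMode_qMode (s : ℤ ≃ ι) (i j : ℤ) :
    qMode s i * qMode s j + qMode s j * qMode s i = 0 := by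
  unfold qMode
  by_cases hi : i < 0 <;> by_cases hj : j < 0 <;> simp only [hi, hj, if_true, if_false]
  · exact create_create _ _
  · rw [add_comm, annih_create, if_neg (by rw [s.apply_eq_iff_eq]; lia)]
  · rw [annih_create, if_neg (by rw [s.apply_eq_iff_eq]; lia)]
  · exact annih_annih _ _

theorem mMode_mMode (s : ℤ ≃ ι) (i j : ℤ) :
    mMode s i * mMode s j + mMode s j * mMode s i = 0 := by
  unfold mMode
  by_cases hi : i < 0 <;> by_cases hj : j < 0 <;> simp only [hi, hj, if_true, if_false]
  · exact annih_annih _ _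
  · rw [annih_create, if_neg (by rw [s.apply_eq_iff_eq]; lia)]
  · rw [add_comm, annih_create, if_neg (by rw [s.apply_eq_iff_eq]; lia)]
  · exact create_create _ _

/-- The two position signs agree and square to one, so the number operator is a diagonal projection.
It gives the uniqueness of the vacuum and later isolates monomials inside a stable subspace. -/
theorem create_annih_apply (i : ι) (w : Fock ι) (S : Finset ι) :
    create i (annih i w) S = if i ∈ S then w S else 0 := by
  induction w using Finsupp.induction_linear with
  | zero => simp
  | add u w hu hw =>
    rw [map_add, map_add, Finsupp.add_apply, hu, hw, Finsupp.add_apply]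
    split_ifs <;> simp
  | single T c =>
    have : Finsupp.single T c = c • mono T := by simp [mono]
    rw [this, map_smul, map_smul, annih_mono]
    by_cases hT : i ∈ T
    · rw [if_pos hT, map_smul, create_mono, if_neg (Finset.notMem_erase i T),
        Finset.insert_erase hT, sgn_erase hT, if_neg (lt_irrefl i), one_mul,
        smul_smul (sgn T i), sgn_mul_self, one_smul]
      by_cases hS : i ∈ S
      · rw [if_pos hS]
      · have hne : T ≠ S := fun e => hS (e ▸ hT)
        simp [hS, mono, hne]
    · rw [if_neg hT, map_zero, smul_zero]
      by_cases hS : i ∈ S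
      · have hne : T ≠ S := fun e => hT (e ▸ hS)
        simp [mono, hne]
      · simp [hS]

/-- A vector killed by all annihilation operators is a multiple of the vacuum. -/
theorem eq_smul_vac {v : Fock ι} (h : ∀ i, annih i v = 0) : v = v ∅ • vac := by
  refine Finsupp.ext fun S => ?_
  rcases S.eq_empty_or_nonempty with rfl | ⟨i, hi⟩
  · simp [vac, mono]
  · have h1 := create_annih_apply i v S
    rw [h i, map_zero, if_pos hi] at h1
    have hS : (∅ : Finset ι) ≠ S := fun e => by simp [← e] at hi
    rw [← h1]
    simp [vac, mono, hS]

theorem create_apply_empty (i : ι) (v : Fock ι) : create i v ∅ = 0 := by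
  induction v using Finsupp.induction_linear with
  | zero => simp
  | add u w hu hw => simp only [map_add, Finsupp.add_apply, hu, hw, add_zero]
  | single T c =>
    have : Finsupp.single T c = c • mono T := by simp [mono]
    rw [this, map_smul, create_mono]
    split_ifs
    · simp
    · simp [mono]

/-- An operator commuting with all modes is a scalar. -/
theorem eq_smul_one_of_commute (s : ℤ ≃ ι) {D : Module.End ℂ (Fock ι)}
    (hq : ∀ k, D * qMode s k = qMode s k * D) (hm : ∀ k, D * mMode s k = mMode s k * D) :
    D = D vac ∅ • 1 := by
  have hc : ∀ i, D * create i = create i * D := by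
    intro i
    obtain ⟨k, rfl⟩ := s.surjective i
    by_cases hk : k < 0
    · simpa [qMode, hk] using hq k
    · simpa [mMode, hk] using hm k
  have ha : ∀ i, D * annih i = annih i * D := by
    intro i
    obtain ⟨k, rfl⟩ := s.surjective i
    by_cases hk : k < 0
    · simpa [mMode, hk] using hm k
    · simpa [qMode, hk] using hq k
  -- D commutes with the annihilation operators, so `D vac` is killed by all of them. The kernel of
  -- D minus this scalar then contains the vacuum and is stable under creation, hence is everything.
  have h0 : D vac = D vac ∅ • vac := eq_smul_vac fun i => by
    have := LinearMap.congr_fun (ha i) vac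
    rw [Module.End.mul_apply, Module.End.mul_apply, annih_vac, map_zero] at this
    exact this.symm
  have htop := eq_top_of_vac_mem (LinearMap.ker (D - D vac ∅ • 1)) (by
      rw [LinearMap.mem_ker, LinearMap.sub_apply, LinearMap.smul_apply, Module.End.one_apply,
        ← h0, sub_self])
    (fun i v hv => by
      rw [LinearMap.mem_ker, LinearMap.sub_apply, LinearMap.smul_apply, Module.End.one_apply,
        sub_eq_zero] at hv ⊢
      have := LinearMap.congr_fun (hc i) v
      rw [Module.End.mul_apply, Module.End.mul_apply, hv, map_smul] at this
      exact this)
  rw [LinearMap.ker_eq_top] at htop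
  exact sub_eq_zero.1 htop

/-- The charged fermions on a Fock space with modes indexed by `s : ℤ ≃ ι`. -/
def pairedModes (s : ℤ ≃ ι) : PairedModes (Fock ι) where
  q := qMode s
  m := mMode s
  vac := vac
  ev := Finsupp.lapply ∅
  q_m := qMode_mMode s
  q_q := qMode_qMode s
  m_m := mMode_mMode s
  finite_q v := ((finite_annih v).preimage s.injective.injOn).subset fun i hi => by
    have h := hi.2
    rwa [qMode, if_neg hi.1.not_gt] at h
  finite_m v := ((finite_annih v).preimage s.injective.injOn).subset fun i hi => by
    have h := hi.2
    rwa [mMode, if_pos hi.1] at h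
  q_vac i hi := by rw [qMode, if_neg hi.not_gt, annih_vac]
  m_vac i hi := by rw [mMode, if_pos hi, annih_vac]
  ev_vac := by simp [vac, mono]
  ev_q i v hi := by
    rw [qMode, if_pos hi]
    exact create_apply_empty _ v
  eq_smul_one _ hq hm := eq_smul_one_of_commute s hq hm

end Fock

/-! ### Modes of the currents -/

namespace FormalField

variable {V : Type} [AddCommGroup V] [Module ℂ V]

theorem coeff_reflect (a : VertexOperator ℂ V) (m : ℤ) :
    coeff (reflect a) m = ((-1 : ℂ) ^ m) • coeff a m := rfl

theorem coeff_mulZ (k : ℤ) (a : VertexOperator ℂ V) (m : ℤ) :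
    coeff (mulZ k a) m = coeff a (m - k) := rfl

theorem coeff_derivZ (a : VertexOperator ℂ V) (m : ℤ) :
    coeff (derivZ a) m = ((m : ℂ) + 1) • coeff a (m + 1) := rfl

theorem coeff_derivZSq (a : VertexOperator ℂ V) (m : ℤ) :
    coeff (derivZSq a) m = ((m : ℂ) / 2 + 1) • coeff a (m + 2) := by
  rw [derivZSq, map_smul, Pi.smul_apply, coeff_mulZ, coeff_derivZ, smul_smul,
    show m - -1 + 1 = m + 2 by ring]
  congr 1
  push_cast
  ring

theorem coeff_derivZ_iterate (a : VertexOperator ℂ V) (k : ℕ) (m : ℤ) :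
    coeff (derivZ^[k] a) m = (descPochhammer ℂ k).eval ((m : ℂ) + k) • coeff a (m + k) := by
  induction k generalizing m with
  | zero => simp
  | succ k ih =>
    rw [Function.iterate_succ_apply', coeff_derivZ, ih, smul_smul, descPochhammer_succ_right,
      show m + 1 + (k : ℤ) = m + ((k + 1 : ℕ) : ℤ) by push_cast; ring]
    congr 1
    simp only [Polynomial.eval_mul, Polynomial.eval_sub, Polynomial.eval_X,
      Polynomial.eval_natCast]
    push_cast
    rw [show (m : ℂ) + 1 + k = m + (k + 1) by ring]
    ring

/-- The operator ∂_{z²} treats z^{2j} as the j-th power of z², so the coefficient taken from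
exponent m + 2k = 2j acquires the falling factorial of j = m/2 + k. -/
theorem coeff_derivZSq_iterate (a : VertexOperator ℂ V) (k : ℕ) (m : ℤ) :
    coeff (derivZSq^[k] a) m
      = (descPochhammer ℂ k).eval ((m : ℂ) / 2 + k) • coeff a (m + 2 * k) := by
  induction k generalizing m with
  | zero => simp
  | succ k ih =>
    rw [Function.iterate_succ_apply', coeff_derivZSq, ih, smul_smul, descPochhammer_succ_right,
      show m + 2 + 2 * (k : ℤ) = m + 2 * ((k + 1 : ℕ) : ℤ) by push_cast; ring]
    congr 1
    simp only [Polynomial.eval_mul, Polynomial.eval_sub, Polynomial.eval_X,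
      Polynomial.eval_natCast]
    push_cast
    rw [show ((m : ℂ) + 2) / 2 + k = m / 2 + (k + 1) by ring]
    ring

theorem coeff_sub_reflect (a : VertexOperator ℂ V) (m : ℤ) :
    coeff (a - reflect a) m = if Odd m then (2 : ℂ) • coeff a m else 0 := by
  rw [map_sub, Pi.sub_apply, coeff_reflect]
  split_ifs with h
  · rw [h.neg_one_zpow, two_smul, neg_one_smul, sub_neg_eq_add]
  · rw [(Int.not_odd_iff_even.1 h).neg_one_zpow, one_smul, sub_self]

theorem coeff_add_reflect (a : VertexOperator ℂ V) (m : ℤ) :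
    coeff (a + reflect a) m = if Odd m then 0 else (2 : ℂ) • coeff a m := by
  rw [map_add, Pi.add_apply, coeff_reflect]
  split_ifs with h
  · rw [h.neg_one_zpow, neg_one_smul, add_neg_cancel]
  · rw [(Int.not_odd_iff_even.1 h).neg_one_zpow, one_smul, two_smul]

theorem coeff_normalOrd_derivZ (a b : VertexOperator ℂ V) (k : ℕ) (n : ℤ) (v : V) :
    coeff (normalOrd a (derivZ^[k] b)) (-(k : ℤ) - n - 1) v
      = ∑ᶠ j : ℤ, (descPochhammer ℂ k).eval (j : ℂ) •
        (if j + n < 0 then coeff a (-1 - (j + n)) * coeff b j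
          else -(coeff b j * coeff a (-1 - (j + n)))) v := by
  -- The sum over the exponent i of a becomes a sum over j = -1 - n - i, the exponent of b before
  -- differentiation. Then 0 ≤ i means j + n < 0, so the two conventions of normal ordering agree.
  rw [coeff_normalOrd, ← finsum_comp_equiv (Equiv.subLeft (-1 - n))]
  refine finsum_congr fun j => ?_
  rw [normalOrdCoeff, Equiv.subLeft_apply, coeff_derivZ_iterate,
    show -(k : ℤ) - n - 1 - (-1 - n - j) + k = j by ring, show -1 - n - j = -1 - (j + n) by ring]
  have h : (((-(k : ℤ) - n - 1 - (-1 - (j + n)) : ℤ) : ℂ)) + k = j := by push_cast; ring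
  rw [h]
  by_cases hj : j + n < 0
  · rw [if_pos hj, if_pos (by lia), mul_smul_comm, LinearMap.smul_apply]
  · rw [if_neg hj, if_neg (by lia), smul_mul_assoc, ← smul_neg, LinearMap.smul_apply]

theorem coeff_normalOrd_derivZSq (a : VertexOperator ℂ V) (k : ℕ) (n : ℤ) (v : V) :
    coeff (mulZ (-1) (normalOrd (a - reflect a) (derivZSq^[k] (a + reflect a))))
        (-2 * (k : ℤ) - 2 * n - 2) v
      = ∑ᶠ j : ℤ, (4 * (descPochhammer ℂ k).eval (j : ℂ)) •
        (if j + n < 0 then coeff a (-1 - 2 * (j + n)) * coeff a (2 * j)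
          else -(coeff a (2 * j) * coeff a (-1 - 2 * (j + n)))) v := by
  rw [coeff_mulZ, coeff_normalOrd]
  have hinj : Function.Injective fun j : ℤ => -1 - 2 * (j + n) := fun x y h => by
    simp only at h; lia
  -- Only odd exponents occur in a(z) - a(-z). They are parametrized by i = -1 - 2(j + n), where
  -- again 0 ≤ i means j + n < 0. The factor 4 comes from both fields doubling their surviving
  -- coefficients.
  rw [← finsum_mem_univ, finsum_mem_inter_support_eq _ Set.univ
    (Set.range fun j : ℤ => -1 - 2 * (j + n)), finsum_mem_range hinj]
  · refine finsum_congr fun j => ?_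
    have hodd : Odd (-1 - 2 * (j + n)) := by rw [Int.odd_iff]; lia
    have heven : ¬Odd (2 * j) := by rw [Int.odd_iff]; lia
    rw [normalOrdCoeff, coeff_derivZSq_iterate, coeff_sub_reflect, coeff_add_reflect,
      show -2 * (k : ℤ) - 2 * n - 2 - -1 - (-1 - 2 * (j + n)) + 2 * k = 2 * j by ring,
      if_pos hodd, if_neg heven]
    have h : (((-2 * (k : ℤ) - 2 * n - 2 - -1 - (-1 - 2 * (j + n)) : ℤ) : ℂ)) / 2 + k = j := by
      push_cast; ring
    rw [h]
    by_cases hj : j + n < 0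
    · rw [if_pos hj, if_pos (by lia), mul_smul_comm, mul_smul_comm, smul_mul_assoc, smul_smul,
        smul_smul, LinearMap.smul_apply]
      congr 1
      ring
    · rw [if_neg hj, if_neg (by lia), smul_mul_assoc, smul_mul_assoc, mul_smul_comm, smul_smul,
        smul_smul, ← smul_neg, LinearMap.smul_apply]
      congr 1
      ring
  · refine Set.ext fun i => ?_
    simp only [Set.mem_inter_iff, Set.mem_univ, true_and, Set.mem_range, Function.mem_support]
    refine ⟨fun hi => ⟨?_, hi⟩, And.right⟩
    by_contra hc
    have hodd : ¬Odd i := by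
      rintro ⟨l, rfl⟩
      exact hc ⟨-1 - l - n, by ring⟩
    refine hi ?_
    rw [normalOrdCoeff, coeff_sub_reflect, if_neg hodd]
    simp

/-- An odd exponent from the first field and an even one from the second have odd sum, which the
factor z⁻¹ makes even. -/
theorem coeff_normalOrd_derivZSq_odd (a : VertexOperator ℂ V) (k : ℕ) {m : ℤ} (hm : Odd m) :
    coeff (mulZ (-1) (normalOrd (a - reflect a) (derivZSq^[k] (a + reflect a)))) m = 0 := by
  refine LinearMap.ext fun v => ?_
  rw [coeff_mulZ, coeff_normalOrd]
  refine finsum_eq_zero_of_forall_eq_zero fun i => ?_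
  rw [normalOrdCoeff, coeff_derivZSq_iterate, coeff_sub_reflect, coeff_add_reflect]
  by_cases hi : Odd i
  · have h : Odd (m - -1 - i + 2 * k) := by rw [Int.odd_iff] at *; lia
    rw [if_pos h]
    simp
  · rw [if_neg hi]
    simp

end FormalField

/-! ### The elements J^k_n and falling factorials -/

namespace DiffCircle

/-- The classical identity t^k ∂_t^k = θ(θ-1)⋯(θ-k+1) with θ = t∂_t, multiplied by (-1)^k t^{-k}. -/
theorem neg_derivT_pow (k : ℕ) :
    (-derivT) ^ k = homog (-k) ((-1 : ℂ) ^ k • descPochhammer ℂ k) := by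
  induction k with
  | zero => simp [← mulOp_T, mulOp]; rfl
  | succ k ih =>
    rw [pow_succ', ih, derivT_eq, ← map_neg, homog_mul, descPochhammer_succ_right]
    rw [show (-1 : ℤ) + -(k : ℤ) = -((k + 1 : ℕ) : ℤ) by push_cast; ring]
    congr 1
    simp only [map_neg, Polynomial.taylor_X, Polynomial.smul_eq_C_mul, Int.cast_neg,
      Int.cast_natCast, map_pow, map_one, map_natCast]
    ring

theorem jOp_eq (k : ℕ) (n : ℤ) : jOp k n = hom n ((-1 : ℂ) ^ k • descPochhammer ℂ k) := by
  refine Subtype.ext ?_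
  change mulOp (LaurentPolynomial.T (n + k)) * (-derivT) ^ k = homog n _
  rw [neg_derivT_pow, mulOp_T, homog_mul]
  simp

/-- The falling factorials span the polynomials: X times the k-th one is the (k+1)-st plus k times
the k-th, and repeating this turns X^n times the zeroth into a combination of them. Hence the J^k_n
span 𝒟. -/
theorem descPochhammer_induction {P : ℂ[X] → Prop} (hadd : ∀ f g, P f → P g → P (f + g))
    (hsmul : ∀ (c : ℂ) f, P f → P (c • f)) (h : ∀ k, P (descPochhammer ℂ k)) (f : ℂ[X]) : P f := by
  have hX : ∀ n k : ℕ, P (Polynomial.X ^ n * descPochhammer ℂ k) := by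
    intro n
    induction n with
    | zero => intro k; simpa using h k
    | succ n ih =>
      intro k
      have : (Polynomial.X : ℂ[X]) ^ (n + 1) * descPochhammer ℂ k
          = Polynomial.X ^ n * descPochhammer ℂ (k + 1)
            + (k : ℂ) • (Polynomial.X ^ n * descPochhammer ℂ k) := by
        rw [descPochhammer_succ_right, Polynomial.smul_eq_C_mul, map_natCast]
        ring
      rw [this]
      exact hadd _ _ (ih _) (hsmul _ _ (ih _))
  induction f using Polynomial.induction_on' with
  | add p q hp hq => exact hadd _ _ hp hq
  | monomial n a =>
    have := hsmul a _ (hX n 0)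
    rwa [descPochhammer_zero, mul_one, Polynomial.smul_X_eq_monomial] at this

end DiffCircle

namespace DHat

open DiffCircle

/-- The algebra `𝒟̂` is generated by the elements `J^k_n`. -/
theorem hom_ext {L : Type*} [LieRing L] [LieAlgebra ℂ L] {f g : DHat →ₗ⁅ℂ⁆ L}
    (h : ∀ k n, f (J k n) = g (J k n)) : f = g := by
  have hdesc : ∀ k n, lift (hom n (descPochhammer ℂ k)) = (-1 : ℂ) ^ k • J k n := by
    intro k n
    rw [J, jOp_eq, map_smul, map_smul, smul_smul, ← mul_pow]
    simp
  -- The multiplications by t and t⁻¹ commute in 𝒟 and have cocycle 1, so C is a bracket of the J's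
  -- and its image is determined by theirs.
  have hcen : (central : DHat) = ⁅J 0 1, J 0 (-1)⁆ := by
    rw [J, J, jOp_eq, jOp_eq, lie_lift, pow_zero, one_smul, descPochhammer_zero, psiFun_hom_one,
      lie_hom]
    simp
  refine LieHom.ext fun x => ?_
  induction x using DHat.induction_hom with
  | hadd x y hx hy => rw [map_add, map_add, hx, hy]
  | hcen c => rw [map_smul, map_smul, hcen, LieHom.map_lie, LieHom.map_lie, h, h]
  | hhom r p =>
    induction p using descPochhammer_induction with
    | hadd p q hp hq => rw [map_add, map_add, map_add, map_add, hp, hq]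
    | hsmul c p hp => rw [map_smul, map_smul, map_smul, map_smul, hp]
    | h k => rw [hdesc, map_smul, map_smul, h]

end DHat

/-! ### The neutral and charged currents in terms of paired modes -/

theorem PairedModes.rep_J {V : Type} [AddCommGroup V] [Module ℂ V] (F : PairedModes V) (k : ℕ)
    (n : ℤ) (v : V) :
    F.rep (DHat.J k n) v = (-1 : ℂ) ^ k • ∑ᶠ j : ℤ, (descPochhammer ℂ k).eval (j : ℂ) •
      F.normalPair (j + n) j v := by
  rw [DHat.J, DiffCircle.jOp_eq, F.rep_lift_hom, map_smul, LinearMap.smul_apply, F.current_apply]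

/-- The indexing of the modes of the neutral fermion: `q_i = φ_{2i+1/2}` and `m_i = φ_{-2i-1/2}`. -/
abbrev modesD : PairedModes FockD := pairedModes Equiv.intEquivNat

/-- The indexing of the modes of the charged fermions: `q_i = ψ⁺_i` and `m_i = ψ⁻_{-i-1}`. -/
abbrev modesA : PairedModes FockA := pairedModes (Equiv.subLeft (-1))

theorem intEquivNat_of_neg {i : ℤ} (hi : i < 0) : Equiv.intEquivNat i = (-1 - 2 * i).toNat := by
  obtain ⟨n, rfl⟩ := Int.eq_negSucc_of_lt_zero hi
  change 2 * n + 1 = _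
  lia

theorem intEquivNat_of_nonneg {i : ℤ} (hi : 0 ≤ i) : Equiv.intEquivNat i = (2 * i).toNat := by
  obtain ⟨n, rfl⟩ := Int.eq_ofNat_of_zero_le hi
  change 2 * n = _
  lia

/-- `Equiv.intEquivNat` sends negative integers to odd indices and the others to even ones. As a
result the q's are exactly the coefficients of odd powers in `phiD`, and the m's those of even
powers. -/
theorem modesD_q (i : ℤ) : modesD.q i = phiCoeff (-1 - 2 * i) := by
  change (if i < 0 then create (Equiv.intEquivNat i) else annih (Equiv.intEquivNat i)) = _
  unfold phiCoeff
  by_cases hi : i < 0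
  · rw [if_pos hi, if_pos (by lia), intEquivNat_of_neg hi]
  · rw [if_neg hi, if_neg (by lia), intEquivNat_of_nonneg (by lia)]
    congr 2
    ring

theorem modesD_m (i : ℤ) : modesD.m i = phiCoeff (2 * i) := by
  change (if i < 0 then annih (Equiv.intEquivNat i) else create (Equiv.intEquivNat i)) = _
  unfold phiCoeff
  by_cases hi : i < 0
  · rw [if_pos hi, if_neg (by lia), intEquivNat_of_neg hi]
    congr 2
    ring
  · rw [if_neg hi, if_pos (by lia), intEquivNat_of_nonneg (by lia)]

theorem modesA_q (i : ℤ) : modesA.q i = psiPlusMode i := by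
  change (if i < 0 then create (-1 - i) else annih (-1 - i)) = _
  rw [psiPlusMode, show -1 - i = -i - 1 by ring]

theorem modesA_m (i : ℤ) : modesA.m i = psiMinusMode (-i - 1) := by
  change (if i < 0 then annih (-1 - i) else create (-1 - i)) = _
  unfold psiMinusMode
  rw [show -1 - i = -i - 1 by ring]
  by_cases hi : i < 0
  · rw [if_pos hi, if_neg (by lia)]
  · rw [if_neg hi, if_pos (by lia)]

/-- The prefactor 1/4 undoes the two doublings in φ(z) ∓ φ(-z). What remains is the sum defining the
abstract current. -/
theorem rep_modesD_J (k : ℕ) (n : ℤ) :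
    modesD.rep (DHat.J k n) = coeff (currentD k) (-2 * (k : ℤ) - 2 * n - 2) := by
  refine LinearMap.ext fun v => ?_
  refine (PairedModes.rep_J modesD k n v).trans ?_
  have h := coeff_normalOrd_derivZSq phiD k n v
  have h1 : coeff (currentD k) (-2 * (k : ℤ) - 2 * n - 2) v = ((-1 : ℂ) ^ k / 4) •
      coeff (mulZ (-1) (normalOrd (phiD - reflect phiD) (derivZSq^[k] (phiD + reflect phiD))))
        (-2 * (k : ℤ) - 2 * n - 2) v := by
    simp [currentD]
  rw [h1, h]
  have h2 : ∀ j : ℤ, (4 * (descPochhammer ℂ k).eval (j : ℂ)) •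
        (if j + n < 0 then coeff phiD (-1 - 2 * (j + n)) * coeff phiD (2 * j)
          else -(coeff phiD (2 * j) * coeff phiD (-1 - 2 * (j + n)))) v
      = (4 : ℂ) • (descPochhammer ℂ k).eval (j : ℂ) • modesD.normalPair (j + n) j v := by
    intro j
    rw [mul_smul, PairedModes.normalPair, modesD_q, modesD_m]
    rfl
  rw [finsum_congr h2, ← smul_finsum, smul_smul]
  congr 1
  ring

theorem rep_modesA_J (k : ℕ) (n : ℤ) :
    modesA.rep (DHat.J k n) = coeff (currentA k) (-(k : ℤ) - n - 1) := by
  refine LinearMap.ext fun v => ?_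
  refine (PairedModes.rep_J modesA k n v).trans ?_
  have h := coeff_normalOrd_derivZ psiPlus psiMinus k n v
  have h1 : coeff (currentA k) (-(k : ℤ) - n - 1) v = (-1 : ℂ) ^ k •
      coeff (normalOrd psiPlus (derivZ^[k] psiMinus)) (-(k : ℤ) - n - 1) v := by
    simp [currentA]
  rw [h1, h]
  refine congrArg _ (finsum_congr fun j => ?_)
  rw [PairedModes.normalPair, modesA_q, modesA_m]
  have h2 : coeff psiPlus (-1 - (j + n)) = psiPlusMode (j + n) := by
    change psiPlusMode (-(-1 - (j + n)) - 1) = _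
    congr 1
    ring
  rw [h2]
  rfl

theorem coeff_currentD_odd (k : ℕ) {m : ℤ} (hm : Odd m) : coeff (currentD k) m = 0 := by
  have h := coeff_normalOrd_derivZSq_odd phiD k hm
  rw [currentD, map_smul, Pi.smul_apply]
  exact (congrArg _ h).trans (smul_zero _)

/-! ### Relabelling the modes of a Fock space -/

namespace PairedModes

variable {V W : Type} [AddCommGroup V] [Module ℂ V] [AddCommGroup W] [Module ℂ W]

/-- A linear map commuting with all modes is a homomorphism of representations of `𝒟̂`. -/
theorem map_rep (F : PairedModes V) (G : PairedModes W) (e : V →ₗ[ℂ] W)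
    (hq : ∀ i v, e (F.q i v) = G.q i (e v)) (hm : ∀ i v, e (F.m i v) = G.m i (e v))
    (x : DHat) (v : V) : e (F.rep x v) = G.rep x (e v) := by
  induction x using DHat.induction_hom with
  | hadd x y hx hy =>
    rw [map_add, map_add, LinearMap.add_apply, LinearMap.add_apply, map_add, hx, hy]
  | hcen c => simp [rep_central]
  | hhom r f =>
    rw [rep_lift_hom, rep_lift_hom, current_apply, current_apply,
      map_finsum e (F.finite_smul_normalPair r _ v)]
    refine finsum_congr fun j => ?_
    rw [map_smul, normalPair, normalPair]
    split_ifs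
    · rw [Module.End.mul_apply, Module.End.mul_apply, hq, hm]
    · rw [LinearMap.neg_apply, LinearMap.neg_apply, Module.End.mul_apply, Module.End.mul_apply,
        map_neg, hm, hq]

end PairedModes

namespace Fock

variable {ι κ : Type} [LinearOrder ι] [LinearOrder κ]

/-- The sign of the reordering of the factors of the monomial of `S` under a relabelling `σ`. -/
def reorderSgn (σ : ι ≃ κ) (S : Finset ι) : ℂ :=
  ∏ i ∈ S, ∏ j ∈ S, if i < j ∧ σ j < σ i then -1 else 1

theorem sgn_eq_prod (S : Finset ι) (i : ι) : sgn S i = ∏ j ∈ S, if i < j then -1 else 1 := by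
  rw [sgn, Finset.prod_ite]
  simp

/-- The new factors are those of the pairs {i, j} with j in S. Such a pair is an inversion exactly
when the comparisons of i with j and of σ i with σ j disagree, that is, when the two position signs
have product -1. -/
theorem reorderSgn_insert (σ : ι ≃ κ) {S : Finset ι} {i : ι} (hi : i ∉ S) :
    reorderSgn σ (insert i S)
      = reorderSgn σ S * (sgn S i * sgn (S.map σ.toEmbedding) (σ i)) := by
  have key : (∏ j ∈ S, if i < j ∧ σ j < σ i then (-1 : ℂ) else 1) *
      (∏ j ∈ S, if j < i ∧ σ i < σ j then (-1 : ℂ) else 1)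
      = sgn S i * sgn (S.map σ.toEmbedding) (σ i) := by
    rw [sgn_eq_prod, sgn_eq_prod, Finset.prod_map, ← Finset.prod_mul_distrib,
      ← Finset.prod_mul_distrib]
    refine Finset.prod_congr rfl fun j hj => ?_
    have hij : i ≠ j := fun h => hi (h ▸ hj)
    have hσ : σ i ≠ σ j := fun h => hij (σ.injective h)
    rw [Equiv.coe_toEmbedding]
    rcases lt_or_gt_of_ne hij with h | h <;> rcases lt_or_gt_of_ne hσ with h' | h' <;>
      simp [h, h.not_gt, h', h'.not_gt]
  rw [← key]
  simp only [reorderSgn, Finset.prod_insert hi, Finset.prod_mul_distrib]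
  rw [if_neg (fun h => lt_irrefl _ h.1)]
  ring

theorem reorderSgn_mul_self (σ : ι ≃ κ) (S : Finset ι) :
    reorderSgn σ S * reorderSgn σ S = 1 := by
  simp only [reorderSgn, ← Finset.prod_mul_distrib]
  refine Finset.prod_eq_one fun i _ => ?_
  refine Finset.prod_eq_one fun j _ => ?_
  split_ifs <;> simp

theorem map_ext {ι : Type} {W : Type*} [AddCommMonoid W] [Module ℂ W] {A B : Fock ι →ₗ[ℂ] W}
    (h : ∀ S, A (mono S) = B (mono S)) : A = B := by
  refine Finsupp.lhom_ext fun S c => ?_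
  have : Finsupp.single S c = c • mono S := by simp [mono]
  rw [this, map_smul, map_smul, h]

/-- The map of Fock spaces given by a relabelling of the modes. -/
def relabelMap (σ : ι ≃ κ) : Fock ι →ₗ[ℂ] Fock κ :=
  Finsupp.linearCombination ℂ fun S => reorderSgn σ S • mono (S.map σ.toEmbedding)

theorem relabelMap_mono (σ : ι ≃ κ) (S : Finset ι) :
    relabelMap σ (mono S) = reorderSgn σ S • mono (S.map σ.toEmbedding) := by
  simp [relabelMap, mono]

/-- The isomorphism of Fock spaces given by a relabelling of the modes. -/
def relabel (σ : ι ≃ κ) : Fock ι ≃ₗ[ℂ] Fock κ :=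
  LinearEquiv.ofLinearMap (relabelMap σ)
    (Finsupp.linearCombination ℂ fun T =>
      reorderSgn σ (T.map σ.symm.toEmbedding) • mono (T.map σ.symm.toEmbedding))
    (map_ext fun T => by
      have h : ((T.map σ.symm.toEmbedding).map σ.toEmbedding) = T := by ext; simp
      have h1 : (Finsupp.linearCombination ℂ fun T =>
          reorderSgn σ (T.map σ.symm.toEmbedding) • mono (T.map σ.symm.toEmbedding)) (mono T)
          = reorderSgn σ (T.map σ.symm.toEmbedding) • mono (T.map σ.symm.toEmbedding) := by
        simp [mono]
      rw [LinearMap.comp_apply, h1, map_smul, relabelMap_mono, smul_smul, reorderSgn_mul_self,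
        one_smul, h]
      rfl)
    (map_ext fun S => by
      have h : ((S.map σ.toEmbedding).map σ.symm.toEmbedding) = S := by ext; simp
      rw [LinearMap.comp_apply, relabelMap_mono, map_smul]
      have h1 : (Finsupp.linearCombination ℂ fun T =>
          reorderSgn σ (T.map σ.symm.toEmbedding) • mono (T.map σ.symm.toEmbedding))
          (mono (S.map σ.toEmbedding)) = reorderSgn σ S • mono S := by
        simp only [mono, Finsupp.linearCombination_single, h, one_smul]
      rw [h1, smul_smul, reorderSgn_mul_self, one_smul]
      rfl)

theorem relabel_mono (σ : ι ≃ κ) (S : Finset ι) :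
    relabel σ (mono S) = reorderSgn σ S • mono (S.map σ.toEmbedding) :=
  relabelMap_mono σ S

/-- The reordering sign is made for this: by `reorderSgn_insert` it exchanges the position sign of i
for that of σ i. -/
theorem relabel_create (σ : ι ≃ κ) (i : ι) (v : Fock ι) :
    relabel σ (create i v) = create (σ i) (relabel σ v) := by
  have h : (relabel σ).toLinearMap ∘ₗ create i = create (σ i) ∘ₗ (relabel σ).toLinearMap := by
    refine map_ext fun S => ?_
    change relabel σ (create i (mono S)) = create (σ i) (relabel σ (mono S))
    rw [create_mono, relabel_mono, map_smul, create_mono]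
    by_cases hi : i ∈ S
    · simp [hi]
    · rw [if_neg hi, if_neg (by simpa using hi), map_smul, relabel_mono, reorderSgn_insert σ hi,
        Finset.map_insert, smul_smul, smul_smul]
      congr 1
      linear_combination (reorderSgn σ S * sgn (S.map σ.toEmbedding) (σ i)) * sgn_mul_self S i
  exact LinearMap.congr_fun h v

theorem relabel_annih (σ : ι ≃ κ) (i : ι) (v : Fock ι) :
    relabel σ (annih i v) = annih (σ i) (relabel σ v) := by
  have h : (relabel σ).toLinearMap ∘ₗ annih i = annih (σ i) ∘ₗ (relabel σ).toLinearMap := by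
    refine map_ext fun S => ?_
    change relabel σ (annih i (mono S)) = annih (σ i) (relabel σ (mono S))
    rw [annih_mono, relabel_mono, map_smul, annih_mono]
    by_cases hi : i ∈ S
    · have h1 := reorderSgn_insert σ (Finset.notMem_erase i S)
      rw [Finset.insert_erase hi] at h1
      have h2 : sgn (S.erase i) i = sgn S i := by
        rw [sgn_erase hi, if_neg (lt_irrefl i), one_mul]
      have h3 : (S.erase i).map σ.toEmbedding = (S.map σ.toEmbedding).erase (σ i) :=
        Finset.map_erase _ _ _
      have h4 : σ i ∈ S.map σ.toEmbedding := by simpa using hi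
      have h5 : sgn ((S.map σ.toEmbedding).erase (σ i)) (σ i) = sgn (S.map σ.toEmbedding) (σ i) := by
        rw [sgn_erase h4, if_neg (lt_irrefl _), one_mul]
      rw [if_pos hi, if_pos h4, map_smul, relabel_mono, smul_smul, smul_smul, h1, h2, h3, h5]
      congr 1
      linear_combination -(reorderSgn σ (S.erase i) * sgn S i) *
        sgn_mul_self (S.map σ.toEmbedding) (σ i)
    · rw [if_neg hi, if_neg (by simpa using hi), map_zero, smul_zero]
  exact LinearMap.congr_fun h v

theorem relabel_rep (s : ℤ ≃ ι) (σ : ι ≃ κ) (x : DHat) (v : Fock ι) :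
    relabel σ ((pairedModes s).rep x v) = (pairedModes (s.trans σ)).rep x (relabel σ v) := by
  refine PairedModes.map_rep (pairedModes s) (pairedModes (s.trans σ)) (relabel σ).toLinearMap
    (fun i v => ?_) (fun i v => ?_) x v
  · change relabel σ (qMode s i v) = qMode (s.trans σ) i (relabel σ v)
    unfold qMode
    split_ifs
    · exact relabel_create σ _ v
    · exact relabel_annih σ _ v
  · change relabel σ (mMode s i v) = mMode (s.trans σ) i (relabel σ v)
    unfold mMode
    split_ifs
    · exact relabel_annih σ _ v
    · exact relabel_create σ _ v

end Fock

/-! ### Irreducibility -/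

namespace PairedModes

open DiffCircle

variable {V : Type} [AddCommGroup V] [Module ℂ V]

/-- A stable subspace is stable under every `:q_i m_j:`, by interpolation. -/
theorem normalPair_mem (F : PairedModes V) {U : Submodule ℂ V}
    (hU : ∀ x, ∀ v ∈ U, F.rep x v ∈ U) (i j : ℤ) {v : V} (hv : v ∈ U) :
    F.normalPair i j v ∈ U := by
  -- The nodes are j and all indices whose term does not kill v. The Lagrange basis polynomial at j
  -- then selects the single term :q_i m_j: v.
  set t := insert j (F.finite_normalPair (i - j) v).toFinset with ht
  have hinj : Set.InjOn (fun k : ℤ => (k : ℂ)) t := fun a _ b _ h => Int.cast_injective h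
  have h := hU (DHat.lift (hom (i - j) (Lagrange.basis t (fun k : ℤ => (k : ℂ)) j))) v hv
  rw [rep_lift_hom, current_apply, finsum_eq_single _ j,
    Lagrange.eval_basis_self hinj (Finset.mem_insert_self _ _), one_smul, add_sub_cancel] at h
  · exact h
  · intro k hk
    by_cases hkt : k ∈ t
    · rw [Lagrange.eval_basis_of_ne hk.symm hkt, zero_smul]
    · have : F.normalPair (k + (i - j)) k v = 0 := by
        by_contra hc
        exact hkt (Finset.mem_insert_of_mem ((Set.Finite.mem_toFinset _).2 hc))
      rw [this, smul_zero]

theorem q_m_mem (F : PairedModes V) {U : Submodule ℂ V} (hU : ∀ x, ∀ v ∈ U, F.rep x v ∈ U)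
    (i j : ℤ) {v : V} (hv : v ∈ U) : F.q i (F.m j v) ∈ U := by
  have h := F.normalPair_mem hU i j hv
  rw [normalPair_eq, LinearMap.sub_apply, Module.End.mul_apply] at h
  refine (Submodule.sub_mem_iff_left U ?_).1 h
  split_ifs
  · exact hv
  · exact U.zero_mem

theorem m_q_mem (F : PairedModes V) {U : Submodule ℂ V} (hU : ∀ x, ∀ v ∈ U, F.rep x v ∈ U)
    (i j : ℤ) {v : V} (hv : v ∈ U) : F.m j (F.q i v) ∈ U := by
  have h := LinearMap.congr_fun (F.q_m i j) v
  rw [LinearMap.add_apply, Module.End.mul_apply, Module.End.mul_apply] at h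
  rw [eq_sub_of_add_eq' h]
  refine U.sub_mem ?_ (F.q_m_mem hU i j hv)
  split_ifs
  · exact hv
  · exact U.zero_mem

end PairedModes

namespace Fock

variable {ι : Type} [LinearOrder ι]

/-- A nonzero subspace stable under the number operators contains a monomial. -/
theorem exists_mono_mem {U : Submodule ℂ (Fock ι)} (hU : ∀ i, ∀ v ∈ U, create i (annih i v) ∈ U)
    (h0 : U ≠ ⊥) : ∃ S, mono S ∈ U := by
  have key : ∀ (n : ℕ) (v : Fock ι), v ∈ U → v ≠ 0 → v.support.card ≤ n → ∃ S, mono S ∈ U := by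
    intro n
    induction n with
    | zero =>
      intro v _ hv0 hn
      exact absurd (Finsupp.support_eq_empty.1 (Finset.card_eq_zero.1 (Nat.le_zero.1 hn))) hv0
    | succ n ih =>
      intro v hv hv0 hn
      -- The number operator at an index lying in S but not in T keeps the term of S and removes
      -- that of T, giving a nonzero vector of U with strictly smaller support.
      have step : ∀ S ∈ v.support, ∀ T ∈ v.support, ∀ i ∈ S, i ∉ T → ∃ S, mono S ∈ U := by
        intro S hS T hT i hiS hiT
        refine ih _ (hU i v hv) (fun h => ?_) (Nat.lt_succ_iff.1 (lt_of_lt_of_le ?_ hn))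
        · have h1 := create_annih_apply i v S
          rw [h, if_pos hiS] at h1
          exact Finsupp.mem_support_iff.1 hS h1.symm
        · refine Finset.card_lt_card ⟨fun R hR => ?_, fun hsub => ?_⟩
          · rw [Finsupp.mem_support_iff, create_annih_apply] at hR
            rw [Finsupp.mem_support_iff]
            exact fun h => hR (by rw [h, ite_self])
          · have := hsub hT
            rw [Finsupp.mem_support_iff, create_annih_apply, if_neg hiT] at this
            exact this rfl
      by_cases h1 : 1 < v.support.card
      · obtain ⟨S, hS, T, hT, hST⟩ := Finset.one_lt_card.1 h1
        obtain ⟨i, hi⟩ : ∃ i, ¬(i ∈ S ↔ i ∈ T) := by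
          by_contra hc
          push Not at hc
          exact hST (Finset.ext hc)
        by_cases hiS : i ∈ S
        · exact step S hS T hT i hiS fun h => hi ⟨fun _ => h, fun _ => hiS⟩
        · exact step T hT S hS i (by tauto) hiS
      · obtain ⟨S, c, hc, rfl⟩ := Finsupp.card_support_eq_one'.1
          (le_antisymm (not_lt.1 h1) (Finset.card_pos.2 (Finsupp.support_nonempty_iff.2 hv0)))
        refine ⟨S, ?_⟩
        have : mono S = c⁻¹ • Finsupp.single S c := by simp [mono, hc]
        exact this ▸ U.smul_mem _ hv
  obtain ⟨v, hv, hv0⟩ := (Submodule.ne_bot_iff U).1 h0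
  exact key _ v hv hv0 le_rfl

/-- Creation and annihilation both toggle the membership of an index. Writing this as a symmetric
difference lets the two cases be treated together. -/
theorem symmDiff_singleton_of_notMem {S : Finset ι} {i : ι} (hi : i ∉ S) :
    symmDiff S {i} = insert i S := by
  ext j
  simp only [Finset.mem_symmDiff, Finset.mem_singleton, Finset.mem_insert]
  by_cases h : j = i
  · simp [h, hi]
  · simp [h]

theorem symmDiff_singleton_of_mem {S : Finset ι} {i : ι} (hi : i ∈ S) :
    symmDiff S {i} = S.erase i := by
  ext j
  simp only [Finset.mem_symmDiff, Finset.mem_singleton, Finset.mem_erase]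
  by_cases h : j = i
  · simp [h, hi]
  · simp [h]

theorem sgn_ne_zero (S : Finset ι) (i : ι) : sgn S i ≠ 0 := fun h => by
  simpa [h] using sgn_mul_self S i

theorem create_mono_of_notMem {S : Finset ι} {i : ι} (hi : i ∉ S) :
    create i (mono S) = sgn S i • mono (symmDiff S {i}) := by
  rw [create_mono, if_neg hi, symmDiff_singleton_of_notMem hi]

theorem annih_mono_of_mem {S : Finset ι} {i : ι} (hi : i ∈ S) :
    annih i (mono S) = sgn S i • mono (symmDiff S {i}) := by
  rw [annih_mono, if_pos hi, symmDiff_singleton_of_mem hi]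

/-- The condition says that q_i creates an absent index or annihilates a present one. On each
monomial exactly one of q_i, m_i is nonzero, and it toggles `s i`. -/
theorem qMode_mono (s : ℤ ≃ ι) (i : ℤ) (S : Finset ι) :
    qMode s i (mono S)
      = if (i < 0 ↔ s i ∉ S) then sgn S (s i) • mono (symmDiff S {s i}) else 0 := by
  unfold qMode
  by_cases hi : i < 0 <;> by_cases hS : s i ∈ S <;> simp only [hi, hS, if_true, if_false,
    not_true_eq_false, not_false_eq_true, iff_false, iff_true, iff_self]
  · rw [create_mono, if_pos hS]
  · exact create_mono_of_notMem hS
  · exact annih_mono_of_mem hS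
  · rw [annih_mono, if_neg hS]

theorem mMode_mono (s : ℤ ≃ ι) (i : ℤ) (S : Finset ι) :
    mMode s i (mono S)
      = if (i < 0 ↔ s i ∉ S) then 0 else sgn S (s i) • mono (symmDiff S {s i}) := by
  unfold mMode
  by_cases hi : i < 0 <;> by_cases hS : s i ∈ S <;> simp only [hi, hS, if_true, if_false,
    not_true_eq_false, not_false_eq_true, iff_false, iff_true, iff_self]
  · exact annih_mono_of_mem hS
  · rw [annih_mono, if_neg hS]
  · rw [create_mono, if_pos hS]
  · exact create_mono_of_notMem hS

/-- Number operators are among the available products: the one at `s k` is q_k m_k for k < 0 and m_k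
q_k for k ≥ 0. -/
theorem create_annih_mem (s : ℤ ≃ ι) {U : Submodule ℂ (Fock ι)}
    (hU : ∀ x, ∀ v ∈ U, (pairedModes s).rep x v ∈ U) (i : ι) {v : Fock ι} (hv : v ∈ U) :
    create i (annih i v) ∈ U := by
  obtain ⟨k, rfl⟩ := s.surjective i
  by_cases hk : k < 0
  · have h : qMode s k (mMode s k v) ∈ U := (pairedModes s).q_m_mem hU k k hv
    rwa [qMode, mMode, if_pos hk, if_pos hk] at h
  · have h : mMode s k (qMode s k v) ∈ U := (pairedModes s).m_q_mem hU k k hv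
    rwa [qMode, mMode, if_neg hk, if_neg hk] at h

end Fock

/-! ### The components of the Fock space of the neutral fermion -/

/-- The degree of the mode with index `n`. -/
def modeDg (n : ℕ) : ℤ := if Odd n then 1 else -1

theorem dg_eq_sum (S : Finset ℕ) : dg S = ∑ n ∈ S, modeDg n := by
  unfold dg modeDg
  rw [Finset.sum_ite]
  simp [sub_eq_add_neg]

theorem dg_symmDiff (S : Finset ℕ) (n : ℕ) :
    dg (symmDiff S {n}) = dg S + if (Odd n ↔ n ∉ S) then 1 else -1 := by
  by_cases hn : n ∈ S
  · rw [symmDiff_singleton_of_mem hn, dg_eq_sum, dg_eq_sum, ← Finset.add_sum_erase S modeDg hn,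
      modeDg]
    by_cases h : Odd n <;> simp [h, hn]
  · rw [symmDiff_singleton_of_notMem hn, dg_eq_sum, dg_eq_sum, Finset.sum_insert hn, modeDg]
    by_cases h : Odd n <;> simp [h, hn] <;> ring

/-- Two different sets of the same degree differ in an index whose change raises the degree. -/
theorem exists_mem_symmDiff {S T : Finset ℕ} (hST : S ≠ T) (h : dg S = dg T) :
    ∃ n ∈ symmDiff S T, (Odd n ↔ n ∉ S) := by
  by_contra hc
  push Not at hc
  -- If no index of the symmetric difference raised the degree, T \ S would consist of even and S \
  -- T of odd numbers. The degree would then drop by the size of S ∆ T in passing to T, forcing S =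
  -- T.
  have h1 : ∑ n ∈ T \ S, modeDg n - ∑ n ∈ S \ T, modeDg n = 0 := by
    rw [Finset.sum_sdiff_sub_sum_sdiff, ← dg_eq_sum, ← dg_eq_sum, h, sub_self]
  have h2 : ∑ n ∈ T \ S, modeDg n = -((T \ S).card : ℤ) := by
    rw [Finset.sum_congr rfl (g := fun _ => (-1 : ℤ)) fun n hn => ?_]
    · simp
    · rw [Finset.mem_sdiff] at hn
      have := hc n (by rw [Finset.mem_symmDiff]; exact Or.inr hn)
      rw [modeDg, if_neg (by tauto)]
  have h3 : ∑ n ∈ S \ T, modeDg n = ((S \ T).card : ℤ) := by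
    rw [Finset.sum_congr rfl (g := fun _ => (1 : ℤ)) fun n hn => ?_]
    · simp
    · rw [Finset.mem_sdiff] at hn
      have := hc n (by rw [Finset.mem_symmDiff]; exact Or.inl hn)
      rw [modeDg, if_pos (by tauto)]
  rw [h2, h3] at h1
  refine hST (subset_antisymm ?_ ?_) <;> rw [← Finset.sdiff_eq_empty_iff_subset,
    ← Finset.card_eq_zero] <;> lia

theorem odd_intEquivNat (i : ℤ) : Odd (Equiv.intEquivNat i) ↔ i < 0 := by
  by_cases hi : i < 0
  · rw [intEquivNat_of_neg hi, Nat.odd_iff]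
    lia
  · rw [intEquivNat_of_nonneg (by lia), Nat.odd_iff]
    lia

theorem component_eq_supported (m : ℤ) :
    component m = Finsupp.supported ℂ ℂ {S : Finset ℕ | dg S = m} :=
  (Finsupp.supported_eq_span_single ℂ _).symm

theorem mono_mem_component {S : Finset ℕ} {m : ℤ} : mono S ∈ component m ↔ dg S = m := by
  refine ⟨fun h => ?_, fun h => Submodule.subset_span ⟨S, h, rfl⟩⟩
  rw [component_eq_supported, Finsupp.mem_supported] at h
  exact h (by simp [mono])

theorem map_component_le {A : Module.End ℂ FockD} {m n : ℤ}
    (h : ∀ S, dg S = m → A (mono S) ∈ component n) {v : FockD} (hv : v ∈ component m) :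
    A v ∈ component n := by
  have h1 : component m ≤ (component n).comap A := by
    refine Submodule.span_le.2 ?_
    rintro _ ⟨S, hS, rfl⟩
    exact h S hS
  exact h1 hv

/-- The degree is the charge of the pair: q_i acts on a monomial only when toggling its index raises
the degree, and m_i only when it lowers it. The products :q_i m_j: therefore preserve each
component. -/
theorem q_mem_component (i : ℤ) {m : ℤ} {v : FockD} (hv : v ∈ component m) :
    modesD.q i v ∈ component (m + 1) := by
  refine map_component_le (fun S hS => ?_) hv
  change qMode Equiv.intEquivNat i (mono S) ∈ _
  rw [qMode_mono]
  split_ifs with h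
  · rw [← odd_intEquivNat] at h
    exact Submodule.smul_mem _ _ (mono_mem_component.2 (by rw [dg_symmDiff, if_pos h, hS]))
  · exact Submodule.zero_mem _

theorem m_mem_component (i : ℤ) {m : ℤ} {v : FockD} (hv : v ∈ component m) :
    modesD.m i v ∈ component (m - 1) := by
  refine map_component_le (fun S hS => ?_) hv
  change mMode Equiv.intEquivNat i (mono S) ∈ _
  rw [mMode_mono]
  split_ifs with h
  · exact Submodule.zero_mem _
  · rw [← odd_intEquivNat] at h
    exact Submodule.smul_mem _ _ (mono_mem_component.2 (by
      rw [dg_symmDiff, if_neg h, hS, sub_eq_add_neg]))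

theorem rep_mem_component (x : DHat) {m : ℤ} {v : FockD} (hv : v ∈ component m) :
    modesD.rep x v ∈ component m := by
  induction x using DHat.induction_hom with
  | hadd x y hx hy => rw [map_add]; exact Submodule.add_mem _ hx hy
  | hcen c => rw [map_smul, PairedModes.rep_central]; exact Submodule.smul_mem _ c hv
  | hhom r f =>
    rw [PairedModes.rep_lift_hom]
    refine (congrArg (· ∈ component m) (PairedModes.current_apply modesD r f v)).mpr ?_
    refine finsum_induction (· ∈ component m) (Submodule.zero_mem _)
      (fun _ _ => Submodule.add_mem _) fun j => Submodule.smul_mem _ _ ?_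
    unfold PairedModes.normalPair
    split_ifs
    · have := q_mem_component (j + r) (m_mem_component j hv)
      rwa [sub_add_cancel] at this
    · have := m_mem_component j (q_mem_component (j + r) hv)
      rw [add_sub_cancel_right] at this
      exact Submodule.neg_mem _ this

/-- If S ≠ T have equal degree, S ∆ T contains an index whose toggling in S raises the degree and
another whose toggling lowers it. A product q_i m_j toggles both, which stays in U, keeps the degree
and brings S closer to T. -/
theorem mono_mem_of_dg_eq {U : Submodule ℂ FockD}
    (hU : ∀ x, ∀ v ∈ U, modesD.rep x v ∈ U) {S T : Finset ℕ} (hS : mono S ∈ U)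
    (h : dg S = dg T) : mono T ∈ U := by
  induction hn : (symmDiff S T).card using Nat.strong_induction_on generalizing S with
  | _ n ih =>
    by_cases hST : S = T
    · exact hST ▸ hS
    obtain ⟨x, hx, hxS⟩ := exists_mem_symmDiff hST h
    obtain ⟨y, hy, hyT⟩ := exists_mem_symmDiff (Ne.symm hST) h.symm
    -- y was chosen to raise the degree of T. As it lies in exactly one of S and T, toggling it in S
    -- lowers the degree.
    have hyS : ¬(Odd y ↔ y ∉ S) := by
      rw [Finset.mem_symmDiff] at hy
      tauto
    have hxy : x ≠ y := by rintro rfl; exact hyS hxS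
    have hxS' : Odd x ↔ x ∉ symmDiff S {y} := by
      rw [hxS, Finset.mem_symmDiff, Finset.mem_singleton]
      tauto
    obtain ⟨i, rfl⟩ := Equiv.intEquivNat.surjective x
    obtain ⟨j, rfl⟩ := Equiv.intEquivNat.surjective y
    refine ih _ ?_ (S := symmDiff (symmDiff S {Equiv.intEquivNat j}) {Equiv.intEquivNat i}) ?_ ?_
      rfl
    · rw [← hn]
      refine Finset.card_lt_card ⟨fun k hk => ?_, fun hsub => ?_⟩
      · by_cases h1 : k = Equiv.intEquivNat i
        · exact h1 ▸ hx
        by_cases h2 : k = Equiv.intEquivNat j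
        · rw [Finset.mem_symmDiff] at hy ⊢
          rw [h2]
          tauto
        · simpa [Finset.mem_symmDiff, h1, h2] using hk
      · have h1 := hsub hx
        simp only [Finset.mem_symmDiff, Finset.mem_singleton] at h1 hx
        tauto
    · have h1 : qMode Equiv.intEquivNat i (mMode Equiv.intEquivNat j (mono S)) ∈ U :=
        modesD.q_m_mem hU i j hS
      -- Neither mode kills the monomial, so up to two nonzero signs the result is the monomial with
      -- both indices toggled.
      rw [mMode_mono, if_neg (by rwa [← odd_intEquivNat]), map_smul, qMode_mono,
        if_pos (by rwa [← odd_intEquivNat])] at h1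
      exact (U.smul_mem_iff (sgn_ne_zero _ _)).1 ((U.smul_mem_iff (sgn_ne_zero _ _)).1 h1)
    · rw [dg_symmDiff, if_pos hxS', dg_symmDiff, if_neg hyS, ← h]
      ring

theorem exists_dg_eq (m : ℤ) : ∃ S, dg S = m := by
  obtain ⟨n, rfl | rfl⟩ := m.eq_nat_or_neg
  · refine ⟨(Finset.range n).map ⟨fun i => 2 * i + 1, fun a b h => by simpa using h⟩, ?_⟩
    rw [dg_eq_sum, Finset.sum_map]
    exact (Finset.sum_congr rfl fun k _ => if_pos (odd_two_mul_add_one k)).trans (by simp)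
  · refine ⟨(Finset.range n).map ⟨fun i => 2 * i, fun a b h => by simpa using h⟩, ?_⟩
    rw [dg_eq_sum, Finset.sum_map]
    exact (Finset.sum_congr rfl fun k _ =>
      if_neg (Nat.not_odd_iff_even.2 (even_two_mul k))).trans (by simp)

/-- A nonzero stable subspace contains a monomial by the number operators, and from it all monomials
of that degree, which span the component. -/
theorem isIrreducibleOn_component (m : ℤ) : IsIrreducibleOn modesD.rep (component m) := by
  refine ⟨fun x v => rep_mem_component x, fun h => ?_, fun U hUm hU => ?_⟩
  · obtain ⟨S, hS⟩ := exists_dg_eq m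
    have := mono_mem_component.2 hS
    rw [h, Submodule.mem_bot] at this
    simp [mono] at this
  · refine or_iff_not_imp_left.2 fun h0 => le_antisymm hUm (Submodule.span_le.2 ?_)
    obtain ⟨S, hS⟩ := exists_mono_mem
      (fun i v hv => create_annih_mem Equiv.intEquivNat hU i hv) h0
    rintro _ ⟨T, hT, rfl⟩
    exact mono_mem_of_dg_eq hU hS ((mono_mem_component.1 (hUm hS)).trans hT.symm)

/-- The degree partitions the monomial basis, and each component is the space of vectors supported
on one block. -/
theorem isInternal_component : DirectSum.IsInternal component := by
  rw [DirectSum.isInternal_submodule_iff_iSupIndep_and_iSup_eq_top]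
  constructor
  · intro m
    have h : ⨆ n, ⨆ (_ : n ≠ m), component n ≤ Finsupp.supported ℂ ℂ {S : Finset ℕ | dg S ≠ m} :=
      iSup₂_le fun n hn => by
        rw [component_eq_supported]
        exact Finsupp.supported_mono fun S hS => (hS : dg S = n).trans_ne hn
    refine Disjoint.mono_right h ?_
    rw [component_eq_supported]
    exact Finsupp.disjoint_supported_supported (Set.disjoint_left.2 fun S hS hS' => hS' hS)
  · rw [eq_top_iff, ← Finsupp.supported_univ, Finsupp.supported_eq_span_single]
    refine Submodule.span_le.2 ?_
    rintro _ ⟨S, _, rfl⟩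
    exact Submodule.mem_iSup_of_mem (dg S) (mono_mem_component.2 rfl)

end

/-! ### The proposition assembled -/

theorem mainTheorem7 :
    ∃ ρ : DHat →ₗ⁅ℂ⁆ Module.End ℂ FockD,
      -- the assignment of fields `∑ J^k_n z ^ (-2k-2n-2) ↦ currentD k` is an action
      (∀ (k : ℕ) (n : ℤ),
        ρ (DHat.J k n) = HVertexOperator.coeff (currentD k) (-2 * (k : ℤ) - 2 * n - 2)) ∧
      (∀ (k : ℕ) (m : ℤ), Odd m → HVertexOperator.coeff (currentD k) m = 0) ∧
      -- the action is determined by the assignment, and the central element acts as the identity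
      (∀ ρ' : DHat →ₗ⁅ℂ⁆ Module.End ℂ FockD,
        (∀ (k : ℕ) (n : ℤ),
          ρ' (DHat.J k n) = HVertexOperator.coeff (currentD k) (-2 * (k : ℤ) - 2 * n - 2)) →
        ρ' = ρ) ∧
      ρ DHat.central = 1 ∧
      -- the decomposition into irreducible submodules
      DirectSum.IsInternal component ∧
      (∀ m : ℤ, IsIrreducibleOn ρ (component m)) ∧
      -- the isomorphism with the Fock space of a pair of charged fermions
      ∃ ρA : DHat →ₗ⁅ℂ⁆ Module.End ℂ FockA,
        (∀ (k : ℕ) (n : ℤ),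
          ρA (DHat.J k n) = HVertexOperator.coeff (currentA k) (-(k : ℤ) - n - 1)) ∧
        ∃ e : FockA ≃ₗ[ℂ] FockD, ∀ (x : DHat) (v : FockA), e (ρA x v) = ρ x (e v) := by
  refine ⟨modesD.rep, rep_modesD_J, fun k m hm => coeff_currentD_odd k hm,
    fun ρ' h => DHat.hom_ext fun k n => (h k n).trans (rep_modesD_J k n).symm,
    modesD.rep_central, isInternal_component, isIrreducibleOn_component,
    modesA.rep, rep_modesA_J,
    -- The bijection undoes the charged indexing i ↦ -1 - i and then applies the neutral one, so
    -- that `modesA.q i` and `modesA.m i` correspond to `modesD.q i` and `modesD.m i`.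
    Fock.relabel ((Equiv.subLeft (-1)).symm.trans Equiv.intEquivNat), fun x v => ?_⟩
  have h : (Equiv.subLeft (-1 : ℤ)).trans ((Equiv.subLeft (-1)).symm.trans Equiv.intEquivNat)
      = Equiv.intEquivNat := by
    rw [← Equiv.trans_assoc, Equiv.self_trans_symm, Equiv.refl_trans]
  have h1 := Fock.relabel_rep (Equiv.subLeft (-1 : ℤ))
    ((Equiv.subLeft (-1)).symm.trans Equiv.intEquivNat) x v
  rwa [h] at h1
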